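/- **Setting.** Let $\mathcal A$ be an irreducible conformal net on a separable Hilbert space $\mathcal H_0$ with vacuum vector $\Omega$; an $\mathcal A$-module is a normal representation of $\mathcal A$ on a separable Hilbert space, and carries the canonical unitary action of $\widetilde{\mathrm{PSU}}(1,1)$ (written $g\xi$), with rotation subgroup $\varrho(t)$ and rotation generator $L_0$. Put $\mathcal H_i^\infty=\bigcap_n\mathscr D(L_0^n)$. A *smooth* operator $T:\mathcal H_i\to\mathcal H_j$ has domain $\mathcal H_i^\infty$, and $T\mathcal H_i^\infty\subset\mathcal H_j^\infty$, $\mathcal H_j^\infty\subset\mathscr D(T^*)$, $T^*\mathcal H_j^\infty\subset\mathcal H_i^\infty$; put $T^\dagger=T^*|_{\mathcal H_j^\infty}$. A dense subspace $\mathscr D_0\subset\mathcal H_i^\infty$ is *QRI* if there are $\delta>0$ and a dense subspace $\mathscr D_\delta\subset\mathscr D_0$ with $\varrho(t)\mathscr D_\delta\subset\mathscr D_0$ for $|t|<\delta$; $T$ is *localizable* if every dense QRI subspace of $\mathcal H_i^\infty$ is a core for $T$. A square of smooth operators $A:\mathcal H_i\to\mathcal H_k$, $B:\mathcal H_j\to\mathcal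 H_l$, $C:\mathcal H_i\to\mathcal H_j$, $D:\mathcal H_k\to\mathcal H_l$ *commutes adjointly* if $DA=BC$ and $CA^\dagger=B^\dagger D$. Let $\mathcal A^\infty(I)$ be the set of $x\in\mathcal A(I)$ acting as smooth operators on all $\mathcal A$-modules. Let $\widetilde{\mathcal J}$ be the set of arg-valued intervals $\widetilde I=(I,\arg_I)$, with $I\subset\mathbb S^1$ a nonempty non-dense open interval and $\arg_I$ a continuous argument on $I$; let $I'$ be the interior of $\mathbb S^1\setminus I$. $\widetilde I$ is *anticlockwise* to $\widetilde J$ if $I\cap J=\emptyset$ and $\arg_J(\zeta)<\arg_I(z)<\arg_J(\zeta)+2\pi$ for all $z\in I$, $\zeta\in J$. Let $\mathscr C$ be a full subcategory of the $\mathcal A$-modules which contains $\mathcal H_0$ and, up to unitary equivalence, is closed under submodules and finite direct sums, and let $(\mathscr C,\boxdot,\beta)$ be a braided $C^*$-tensor category with unit $\mathcal H_0$ and unitary braiding $\beta$; associators and unitors are suppressed. Assume $\mathscr C$ semisimple: every object is unitarily equivalent to a finite direct sum of irreducible modules in $\mathscr C$. Let $\mathcal F$ be a set of objects that *generates* $\mathscr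 C$: every irreducible object is equivalent to a submodule of some $\mathcal H_{i_1}\boxdot\cdots\boxdot\mathcal H_{i_n}$ with $n\ge1$ and all $\mathcal H_{i_m}\in\mathcal F$. **Weak categorical local extensions.** A weak categorical local extension $\mathscr E^w_{\mathrm{loc}}=(\mathcal A,\mathcal F,\boxdot,\mathfrak H)$ consists of sets $\mathfrak H_i(\widetilde I)$ ($\mathcal H_i\in\mathcal F$, $\widetilde I\in\widetilde{\mathcal J}$), increasing in $\widetilde I$, and, for $\mathfrak a\in\mathfrak H_i(\widetilde I)$ and every object $\mathcal H_k$ of $\mathscr C$, smooth localizable operators $\mathcal L(\mathfrak a,\widetilde I):\mathcal H_k\to\mathcal H_i\boxdot\mathcal H_k$ and $\mathcal R(\mathfrak a,\widetilde I):\mathcal H_k\to\mathcal H_k\boxdot\mathcal H_i$ such that, for all $\mathcal H_i,\mathcal H_j\in\mathcal F$, all objects $\mathcal H_k,\mathcal H_{k'},\mathcal H_l$ of $\mathscr C$ and all $\widetilde I,\widetilde J\in\widetilde{\mathcal J}$: (a) if $\widetilde I\subset\widetilde J$ and $\mathfrak a\in\mathfrak H_i(\widetilde I)$ then $\mathcal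 L(\mathfrak a,\widetilde I)=\mathcal L(\mathfrak a,\widetilde J)$ and $\mathcal R(\mathfrak a,\widetilde I)=\mathcal R(\mathfrak a,\widetilde J)$; (b) for $\mathfrak a\in\mathfrak H_i(\widetilde I)$ and $f\in\mathrm{Hom}_{\mathcal A}(\mathcal H_k,\mathcal H_{k'})$, $(\mathbf 1_i\otimes f)\mathcal L(\mathfrak a,\widetilde I)=\mathcal L(\mathfrak a,\widetilde I)f$ and $(f\otimes\mathbf 1_i)\mathcal R(\mathfrak a,\widetilde I)=\mathcal R(\mathfrak a,\widetilde I)f$ on $\mathcal H_k^\infty$; (c) for $\mathfrak a\in\mathfrak H_i(\widetilde I)$, $\mathcal L(\mathfrak a,\widetilde I)=\mathcal R(\mathfrak a,\widetilde I)$ on $\mathcal H_0^\infty$; (d) $\mathcal L(\mathfrak H_i(\widetilde I),\widetilde I)\Omega$ spans a dense subspace of $\mathcal H_i$; (e) $\mathcal L(\mathfrak H_i(\widetilde I),\widetilde I)\mathcal H_k^\infty$ and $\mathcal R(\mathfrak H_i(\widetilde I),\widetilde I)\mathcal H_k^\infty$ span dense subspaces of $\mathcal H_i\boxdot\mathcal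 H_k$ and $\mathcal H_k\boxdot\mathcal H_i$; (f) for $\mathfrak a\in\mathfrak H_i(\widetilde I)$, $\mathcal L(\mathfrak a,\widetilde I)$ and $\mathcal R(\mathfrak a,\widetilde I)$ commute adjointly with the actions of all $x\in\mathcal A^\infty(I')$; (g) if $\widetilde I$ is anticlockwise to $\widetilde J$, $\mathfrak a\in\mathfrak H_i(\widetilde I)$ and $\mathfrak b\in\mathfrak H_j(\widetilde J)$, then $\mathcal L(\mathfrak a,\widetilde I)$ and $\mathcal R(\mathfrak b,\widetilde J)$ commute adjointly, as a square from $\mathcal H_k$ to $\mathcal H_i\boxdot\mathcal H_k\boxdot\mathcal H_j$; (h) for $\mathfrak a\in\mathfrak H_i(\widetilde I)$, $\beta_{i,k}\mathcal L(\mathfrak a,\widetilde I)=\mathcal R(\mathfrak a,\widetilde I)$ on $\mathcal H_k^\infty$; (i) for $\mathfrak a\in\mathfrak H_i(\widetilde I)$ and $g=\varrho(t)$, $t\in\mathbb R$, there is $g\mathfrak a\in\mathfrak H_i(g\widetilde I)$ such that $\mathcal L(g\mathfrak a,g\widetilde I)\eta=g\mathcal L(\mathfrak a,\widetilde I)g^{-1}\eta$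 and $\mathcal R(g\mathfrak a,g\widetilde I)\eta=g\mathcal R(\mathfrak a,\widetilde I)g^{-1}\eta$ for all $\mathcal H_l$ and all $\eta\in\mathcal H_l^\infty$; (j) for all $\mathcal H_{i_1},\dots,\mathcal H_{i_n}\in\mathcal F$ and $\mathfrak a_m\in\mathfrak H_{i_m}(\widetilde I)$, $n\ge1$, the product $\mathcal L(\mathfrak a_n,\widetilde I)\cdots\mathcal L(\mathfrak a_1,\widetilde I)|_{\mathcal H_k^\infty}$ is localizable. It is *Möbius covariant* if (i) holds for all $g\in\widetilde{\mathrm{PSU}}(1,1)$. If $\mathcal F$ is replaced by the class of all objects of $\mathscr C$, it is in particular a weak categorical extension (axioms (a)–(i)), and is written $(\mathcal A,\mathscr C,\boxdot,\mathfrak K)$. **Theorem.** Every weak categorical local extension $\mathscr E^w_{\mathrm{loc}}=(\mathcal A,\mathcal F,\boxdot,\mathfrak H)$ extends to a weak categorical local extension $\mathscr E^w=(\mathcal A,\mathscr C,\boxdot,\mathfrak K)$ with charged fields for all objects of $\mathscr C$: $\mathfrak H_i(\widetilde I)\subset\mathfrak K_i(\widetilde I)$ for $\mathcal H_i\in\mathcal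 F$, and on these labels the operators of $\mathscr E^w$ are those of $\mathscr E^w_{\mathrm{loc}}$. Moreover the fields of $\mathscr E^w$ with charge $\mathcal H_i$ at $\widetilde I$ are exactly those given on all $\mathcal H_k$ by $$\mathcal L(\mathfrak k,\widetilde I)=(G\otimes\mathbf 1_k)\,\mathcal L(\mathfrak a_n,\widetilde I)\cdots\mathcal L(\mathfrak a_1,\widetilde I),\qquad \mathcal R(\mathfrak k,\widetilde I)=(\mathbf 1_k\otimes G)\,\mathcal R(\mathfrak a_1,\widetilde I)\cdots\mathcal R(\mathfrak a_n,\widetilde I),$$ where $n\ge1$, $\mathcal H_{i_1},\dots,\mathcal H_{i_n}\in\mathcal F$, $G\in\mathrm{Hom}_{\mathcal A}(\mathcal H_{i_n}\boxdot\cdots\boxdot\mathcal H_{i_1},\mathcal H_i)$, and $\mathfrak a_m\in\mathfrak H_{i_m}(\widetilde I_m)$ for some $\widetilde I_1,\dots,\widetilde I_n\subset\widetilde I$ such that $\widetilde I_m$ is anticlockwise to $\widetilde I_l$ whenever $m>l$. If $\mathscr E^w_{\mathrm{loc}}$ is Möbius covariant, then so is $\mathscr E^w$. -/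

import Mathlib

open CategoryTheory MonoidalCategory Topology
open scoped ContDiff InnerProductSpace ComplexConjugate

universe u w

noncomputable section

/-! ### Arcs of the circle, and arg-valued arcs -/

/-- An arg-valued interval: a branch, in the universal cover `ℝ` of the unit circle, of a
nonempty non-dense open interval of the circle. -/
structure ArgInterval where
  lo : ℝ
  hi : ℝ
  lo_lt : lo < hi
  hi_lt : hi < lo + 2 * Real.pi

/-- The interval of the circle underlying an arg-valued interval. -/
def ArgInterval.arc (I : ArgInterval) : Set Circle := Circle.exp '' Set.Ioo I.lo I.hi

/-- The nonempty non-dense open intervals of the unit circle. -/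
def Arc : Type := {s : Set Circle // ∃ I : ArgInterval, I.arc = s}

def ArgInterval.toArc (I : ArgInterval) : Arc := ⟨I.arc, I, rfl⟩

/-- Inclusion of arg-valued intervals (inclusion of intervals, with equal arguments). -/
instance : LE ArgInterval := ⟨fun I J => Set.Ioo I.lo I.hi ⊆ Set.Ioo J.lo J.hi⟩

/-- `I` is anticlockwise to `J`: `arg ζ < arg z < arg ζ + 2π` for `z` in `I` and `ζ` in `J`. -/
def ArgInterval.Anticlockwise (I J : ArgInterval) : Prop :=
  ∀ x ∈ Set.Ioo I.lo I.hi, ∀ y ∈ Set.Ioo J.lo J.hi, y < x ∧ x < y + 2 * Real.pi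

/-- The clockwise complement: the interior of the complement, with `I` anticlockwise to it. -/
def ArgInterval.compl (I : ArgInterval) : ArgInterval :=
  ⟨I.hi - 2 * Real.pi, I.lo, by linarith [I.hi_lt], by linarith [I.lo_lt]⟩

/-! ### Diffeomorphisms of the circle -/

/-- The universal cover of `Diff⁺(S¹)`: the smooth increasing diffeomorphisms `φ` of `ℝ` with
`φ (x + 2π) = φ x + 2π`.  Such a `φ` covers the diffeomorphism `exp (i x) ↦ exp (i φ x)`. -/
def circleDiffSubgroup : Subgroup (Equiv.Perm ℝ) where
  carrier := {φ | ContDiff ℝ ∞ φ ∧ ContDiff ℝ ∞ φ.symm ∧ StrictMono φ ∧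
    ∀ x, φ (x + 2 * Real.pi) = φ x + 2 * Real.pi}
  mul_mem' := by
    rintro f g ⟨hf, hf', hfm, hfp⟩ ⟨hg, hg', hgm, hgp⟩
    refine ⟨hf.comp hg, hg'.comp hf', hfm.comp hgm, fun x => ?_⟩
    simp only [Equiv.Perm.mul_apply, hgp, hfp]
  one_mem' := ⟨contDiff_id, contDiff_id, strictMono_id, fun _ => rfl⟩
  inv_mem' := by
    rintro f ⟨hf, hf', hfm, hfp⟩
    refine ⟨hf', hf, fun x y hxy => ?_, fun x => ?_⟩
    · rw [← hfm.lt_iff_lt]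
      simpa using hxy
    · apply f.injective
      rw [hfp]
      simp

def CircleDiff : Type := circleDiffSubgroup

instance : Group CircleDiff := inferInstanceAs (Group circleDiffSubgroup)

namespace CircleDiff

def toFun (φ : CircleDiff) (x : ℝ) : ℝ := φ.1 x

/-- The action on arg-valued intervals. -/
def act (φ : CircleDiff) (I : ArgInterval) : ArgInterval where
  lo := φ.toFun I.lo
  hi := φ.toFun I.hi
  lo_lt := φ.2.2.2.1 I.lo_lt
  hi_lt := by
    have h := φ.2.2.2.1 I.hi_lt
    rwa [φ.2.2.2.2] at h

/-- The `C^∞` topology: uniform convergence of all derivatives. -/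
abbrev topology : TopologicalSpace CircleDiff :=
  ⨅ k : ℕ, TopologicalSpace.induced
    (fun φ : CircleDiff => UniformFun.ofFun (iteratedDeriv k φ.toFun)) inferInstance

/-- The diffeomorphism of the circle covered by `φ` is the identity on the complement of `I`. -/
def Fixes (φ : CircleDiff) (I : Arc) : Prop :=
  ∀ x : ℝ, Circle.exp x ∈ interior (I.1)ᶜ → Circle.exp (φ.toFun x) = Circle.exp x

/-- `φ` is the identity over the complement of `I`, i.e. it is the canonical lift of a
diffeomorphism localized in `I`. -/
def SupportedIn (φ : CircleDiff) (I : Arc) : Prop :=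
  ∀ x : ℝ, Circle.exp x ∈ interior (I.1)ᶜ → φ.toFun x = x

theorem SupportedIn.fixes {φ : CircleDiff} {I : Arc} (h : φ.SupportedIn I) : φ.Fixes I :=
  fun x hx => by rw [h x hx]

/-- The lift of the rotation by the angle `t`. -/
def rot (t : ℝ) : CircleDiff :=
  ⟨Equiv.addRight t,
    contDiff_id.add contDiff_const,
    by
      have : (⇑(Equiv.addRight t).symm : ℝ → ℝ) = fun x => x + (-t) := by
        ext x; simp
      rw [this]
      exact contDiff_id.add contDiff_const,
    fun x y h => by simpa using h,
    fun x => by simp [add_right_comm]⟩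

end CircleDiff

/-- The group `PSU(1,1)~`, universal cover of `PSU(1,1)`: the lifts to `ℝ` of the maps
`z ↦ (α z + β) / (conj β z + conj α)` with `|α|² - |β|² = 1`. -/
def MobiusCover : Subgroup CircleDiff where
  carrier := {φ | ∃ α β : ℂ, α * conj α - β * conj β = 1 ∧ ∀ x : ℝ,
    (Circle.exp (φ.toFun x) : ℂ) * (conj β * (Circle.exp x : ℂ) + conj α)
      = α * (Circle.exp x : ℂ) + β}
  mul_mem' := by
    rintro f g ⟨α, β, h, hf⟩ ⟨α', β', h', hg⟩
    refine ⟨α * α' + β * conj β', α * β' + β * conj α', ?_, fun x => ?_⟩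
    · simp only [map_add, map_mul, Complex.conj_conj]
      linear_combination (α' * conj α' - β' * conj β') * h + h'
    · have h1 := hf (g.toFun x)
      have h2 := hg x
      change (Circle.exp (f.toFun (g.toFun x)) : ℂ) * _ = _
      simp only [map_add, map_mul, Complex.conj_conj]
      linear_combination (conj β' * (Circle.exp x : ℂ) + conj α') * h1
        + (α - conj β * (Circle.exp (f.toFun (g.toFun x)) : ℂ)) * h2
  one_mem' := ⟨1, 0, by simp, fun x => by
    change (Circle.exp x : ℂ) * _ = _
    simp⟩
  inv_mem' := by
    rintro f ⟨α, β, h, hf⟩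
    refine ⟨conj α, -β, ?_, fun x => ?_⟩
    · simp only [map_neg, Complex.conj_conj]
      linear_combination h
    · have h1 := hf ((f⁻¹).toFun x)
      have h2 : f.toFun ((f⁻¹).toFun x) = x := f.1.apply_symm_apply x
      rw [h2] at h1
      simp only [map_neg, Complex.conj_conj]
      linear_combination -h1

/-- Rotations are Möbius transformations. -/
theorem CircleDiff.rot_mem (t : ℝ) : CircleDiff.rot t ∈ MobiusCover := by
  refine ⟨(Circle.exp (t / 2) : ℂ), 0, ?_, fun x => ?_⟩
  · rw [map_zero, mul_zero, sub_zero, Complex.mul_conj, Circle.normSq_coe, Complex.ofReal_one]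
  · change (Circle.exp (x + t) : ℂ) * _ = _
    have e : Circle.exp (x + t) = Circle.exp x * Circle.exp (t / 2) * Circle.exp (t / 2) := by
      rw [← Circle.exp_add, ← Circle.exp_add]; congr 1; ring
    have h2 : (Circle.exp (t / 2) : ℂ) * conj (Circle.exp (t / 2) : ℂ) = 1 := by
      rw [Complex.mul_conj, Circle.normSq_coe, Complex.ofReal_one]
    rw [e, Circle.coe_mul, Circle.coe_mul]
    simp only [map_zero, zero_mul, zero_add, add_zero]
    linear_combination (Circle.exp x : ℂ) * (Circle.exp (t / 2) : ℂ) * h2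

/-- The rotation subgroup `ϱ`, lifted to `PSU(1,1)~`. -/
def rho (t : ℝ) : MobiusCover := ⟨CircleDiff.rot t, CircleDiff.rot_mem t⟩

/-! ### Conformal nets -/

section Unitaries

variable (H : Type u) [NormedAddCommGroup H] [InnerProductSpace ℂ H] [CompleteSpace H]

/-- The unitary scalars. -/
def phases : Subgroup (unitary (H →L[ℂ] H)) where
  carrier := {V | ∃ c : unitary ℂ, (V : H →L[ℂ] H) = (c : ℂ) • 1}
  mul_mem' := by
    rintro V W ⟨c, hc⟩ ⟨d, hd⟩
    exact ⟨c * d, by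
      rw [Submonoid.coe_mul, hc, hd, smul_mul_smul_comm, mul_one, Submonoid.coe_mul]⟩
  one_mem' := ⟨1, by simp⟩
  inv_mem' := by
    rintro V ⟨c, hc⟩
    refine ⟨c⁻¹, ?_⟩
    change star (V : H →L[ℂ] H) = (star (c : ℂ)) • 1
    rw [hc, star_smul, star_one]

instance : (phases H).Normal where
  conj_mem := by
    rintro V ⟨c, hc⟩ W
    refine ⟨c, ?_⟩
    have h : ((W * V * W⁻¹ : unitary (H →L[ℂ] H)) : H →L[ℂ] H)
        = (W : H →L[ℂ] H) * V * ((W⁻¹ : unitary (H →L[ℂ] H)) : H →L[ℂ] H) := rfl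
    have h' : (W : H →L[ℂ] H) * ((W⁻¹ : unitary (H →L[ℂ] H)) : H →L[ℂ] H) = 1 :=
      congrArg Subtype.val (mul_inv_cancel W)
    rw [h, hc, mul_smul_comm, mul_one, smul_mul_assoc, h']

/-- The strong operator topology on the unitary group. -/
abbrev strongTopology : TopologicalSpace (unitary (H →L[ℂ] H)) :=
  TopologicalSpace.induced (fun V (ξ : H) => (V : H →L[ℂ] H) ξ) inferInstance

/-- The projective unitary group, with the quotient of the strong operator topology. -/
abbrev ProjUnitary : Type u := unitary (H →L[ℂ] H) ⧸ phases H

abbrev projTopology : TopologicalSpace (ProjUnitary H) :=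
  TopologicalSpace.coinduced (QuotientGroup.mk' (phases H)) (strongTopology H)

end Unitaries

/-- An (irreducible) conformal net on the separable Hilbert space `H`.  The projective
representation of `Diff⁺(S¹)` and the representation of `PSU(1,1)` are given as representations
of the universal covers that are trivial on the deck transformation `rot (2π)`. -/
structure ConformalNet (H : Type u) [NormedAddCommGroup H] [InnerProductSpace ℂ H]
    [CompleteSpace H] [TopologicalSpace.SeparableSpace H] where
  /-- the local algebras -/
  alg : Arc → VonNeumannAlgebra H
  isotony : ∀ {I J : Arc}, I.1 ⊆ J.1 → ∀ {x}, x ∈ alg I → x ∈ alg J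
  locality : ∀ {I J : Arc}, Disjoint I.1 J.1 → ∀ {x y}, x ∈ alg I → y ∈ alg J → x * y = y * x
  /-- the projective unitary representation of `Diff⁺(S¹)` -/
  U : CircleDiff →* ProjUnitary H
  U_deck : U (CircleDiff.rot (2 * Real.pi)) = 1
  U_continuous : Continuous[CircleDiff.topology, projTopology H] U
  /-- the unitary representation of `PSU(1,1)` -/
  u : MobiusCover →* unitary (H →L[ℂ] H)
  u_deck : u (rho (2 * Real.pi)) = 1
  u_lifts : ∀ g, QuotientGroup.mk' (phases H) (u g) = U g.1
  u_continuous : Continuous[TopologicalSpace.induced Subtype.val CircleDiff.topology,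
    strongTopology H] u
  covariance : ∀ (φ : CircleDiff) (V : unitary (H →L[ℂ] H)),
    QuotientGroup.mk' (phases H) V = U φ → ∀ (I : ArgInterval) (x : H →L[ℂ] H),
      x ∈ alg I.toArc ↔ (V : H →L[ℂ] H) * x * star (V : H →L[ℂ] H) ∈ alg (φ.act I).toArc
  local_mem : ∀ (φ : CircleDiff) (V : unitary (H →L[ℂ] H)) (I : Arc),
    QuotientGroup.mk' (phases H) V = U φ → φ.Fixes I → (V : H →L[ℂ] H) ∈ alg I
  /-- The generator `-i d/dt` of the rotations is positive. -/
  positive_energy : ∀ ξ η : H,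
    HasDerivAt (fun t : ℝ => (u (rho t) : H →L[ℂ] H) ξ) (Complex.I • η) 0 →
      0 ≤ (⟪ξ, η⟫_ℂ).re
  /-- the vacuum vector -/
  Ω : H
  norm_Ω : ‖Ω‖ = 1
  u_Ω : ∀ g, (u g : H →L[ℂ] H) Ω = Ω
  Ω_unique : ∀ ξ : H, (∀ g, (u g : H →L[ℂ] H) ξ = ξ) → ∃ c : ℂ, ξ = c • Ω
  Ω_cyclic : Dense {ξ : H | ∃ x ∈ Set.centralizer (Set.centralizer
    (⋃ I : Arc, (alg I : Set (H →L[ℂ] H)))), x Ω = ξ}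

section Modules

variable {H : Type u} [NormedAddCommGroup H] [InnerProductSpace ℂ H]
    [CompleteSpace H] [TopologicalSpace.SeparableSpace H]

/-- The local algebra as a `*`-algebra. -/
abbrev ConformalNet.loc (A : ConformalNet H) (I : Arc) : StarSubalgebra ℂ (H →L[ℂ] H) :=
  (A.alg I).toStarSubalgebra

/-- A normal representation of the net on a separable Hilbert space. -/
structure NetModule (A : ConformalNet H) where
  carrier : Type u
  [normed : NormedAddCommGroup carrier]
  [inner : InnerProductSpace ℂ carrier]
  [complete : CompleteSpace carrier]
  [separable : TopologicalSpace.SeparableSpace carrier]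
  rep : ∀ I : Arc, A.loc I →⋆ₐ[ℂ] (carrier →L[ℂ] carrier)
  rep_restrict : ∀ {I J : Arc} (h : I.1 ⊆ J.1) (x : A.loc I),
    rep J ⟨x.1, A.isotony h x.2⟩ = rep I x
  /-- Normality: the vector functionals of the representation are `σ`-weakly continuous. -/
  normal : ∀ (I : Arc) (ξ : carrier), ∃ a b : ℕ → H,
    Summable (fun n => ‖a n‖ ^ 2) ∧ Summable (fun n => ‖b n‖ ^ 2) ∧
      ∀ x : A.loc I, HasSum (fun n => ⟪a n, x.1 (b n)⟫_ℂ) ⟪ξ, rep I x ξ⟫_ℂ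

instance (A : ConformalNet H) : CoeSort (NetModule A) (Type u) := ⟨NetModule.carrier⟩

attribute [instance] NetModule.normed NetModule.inner NetModule.complete NetModule.separable

variable {A : ConformalNet H}

/-- Homomorphisms of modules: bounded operators commuting with the actions of the net. -/
@[ext]
structure NetHom (M N : NetModule A) where
  op : M →L[ℂ] N
  comm : ∀ (I : Arc) (x : A.loc I) (ξ : M), op (M.rep I x ξ) = N.rep I x (op ξ)

/-- The category of modules of the net. -/
instance : Category (NetModule A) where
  Hom M N := NetHom M N
  id M := ⟨ContinuousLinearMap.id ℂ M, fun _ _ _ => rfl⟩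
  comp f g := ⟨g.op ∘L f.op, fun I x ξ => by simp [f.comm, g.comm]⟩

/-- The underlying bounded operator of a homomorphism. -/
def NetModule.op {M N : NetModule A} (f : M ⟶ N) : M →L[ℂ] N := NetHom.op f

theorem NetModule.op_comm {M N : NetModule A} (f : M ⟶ N) (I : Arc) (x : A.loc I) (ξ : M) :
    NetModule.op f (M.rep I x ξ) = N.rep I x (NetModule.op f ξ) := NetHom.comm f I x ξ

/-- The adjoint homomorphism. -/
def NetModule.adj {M N : NetModule A} (f : M ⟶ N) : N ⟶ M where
  op := ContinuousLinearMap.adjoint (NetModule.op f)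
  comm I x ξ := by
    refine ext_inner_left ℂ fun η => ?_
    have key : ∀ (K : NetModule A) (y : A.loc I) (a b : K),
        ⟪a, K.rep I y b⟫_ℂ = ⟪K.rep I (star y) a, b⟫_ℂ := fun K y a b => by
      rw [map_star, ContinuousLinearMap.star_eq_adjoint, ContinuousLinearMap.adjoint_inner_left]
    rw [ContinuousLinearMap.adjoint_inner_right, key, key,
      ContinuousLinearMap.adjoint_inner_right, NetModule.op_comm]

/-- Irreducibility: non-zero, without proper nonzero closed invariant subspaces. -/
def NetModule.IsIrreducible (M : NetModule A) : Prop :=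
  Nontrivial M ∧ ∀ K : Submodule ℂ M, IsClosed (K : Set M) →
    (∀ (I : Arc) (x : A.loc I), ∀ ξ ∈ K, M.rep I x ξ ∈ K) → K = ⊥ ∨ K = ⊤

/-- The vacuum module `H₀`. -/
def ConformalNet.vacuum (A : ConformalNet H) : NetModule A where
  carrier := H
  rep I := (A.loc I).subtype
  rep_restrict _ _ := rfl
  normal I ξ := by
    refine ⟨fun n => if n = 0 then ξ else 0, fun n => if n = 0 then ξ else 0,
      summable_of_ne_finset_zero (s := {0}) fun n hn => by
        have : n ≠ 0 := by simpa using hn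
        simp [this],
      summable_of_ne_finset_zero (s := {0}) fun n hn => by
        have : n ≠ 0 := by simpa using hn
        simp [this], fun x => ?_⟩
    have := hasSum_single (f := fun n : ℕ => ⟪(if n = 0 then ξ else 0 : H),
      x.1 (if n = 0 then ξ else 0)⟫_ℂ) 0 (fun n hn => by simp [hn])
    simpa using this

/-! ### The action of the diffeomorphism group on modules -/

/-- The central extension of the universal cover of `Diff⁺(S¹)` determined by the net: the pairs
`(φ, V)` such that `V` represents `U φ`. -/
def ConformalNet.centralExt (A : ConformalNet H) :
    Subgroup (CircleDiff × unitary (H →L[ℂ] H)) where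
  carrier := {p | QuotientGroup.mk' (phases H) p.2 = A.U p.1}
  mul_mem' := by
    intro p q hp hq
    simp only [Set.mem_ofPred_eq] at hp hq ⊢
    rw [Prod.snd_mul, Prod.fst_mul, map_mul, map_mul, hp, hq]
  one_mem' := by
    simp only [Set.mem_ofPred_eq, Prod.snd_one, Prod.fst_one, map_one]
  inv_mem' := by
    intro p hp
    simp only [Set.mem_ofPred_eq] at hp ⊢
    rw [Prod.snd_inv, Prod.fst_inv, map_inv, map_inv, hp]

/-- The inclusion of `PSU(1,1)~` in the central extension. -/
def ConformalNet.mobius (A : ConformalNet H) : MobiusCover →* A.centralExt where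
  toFun g := ⟨(g.1, A.u g), A.u_lifts g⟩
  map_one' := by
    apply Subtype.ext
    simp
  map_mul' g h := by
    apply Subtype.ext
    simp

/-- The strongly continuous unitary representations `U_M`, one on each module `M`, of the central
extension, with `U_M (φ, V) = π_M (V)` for `φ` localized in an interval. They are intertwined by
homomorphisms, and on the vacuum module `(φ, V)` acts as `V`. -/
structure ConformalAction (A : ConformalNet H) where
  rep : ∀ M : NetModule A, A.centralExt →* unitary (M →L[ℂ] M)
  continuous : ∀ M : NetModule A, Continuous[TopologicalSpace.induced Subtype.val
    (@instTopologicalSpaceProd _ _ CircleDiff.topology (strongTopology H)),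
    strongTopology M.carrier] (rep M)
  loc : ∀ (M : NetModule A) (I : Arc) (p : A.centralExt) (hp : p.1.1.SupportedIn I),
    (rep M p : M →L[ℂ] M) = M.rep I ⟨p.1.2, A.local_mem _ _ I p.2 hp.fixes⟩
  natural : ∀ {M N : NetModule A} (f : M ⟶ N) (p : A.centralExt) (ξ : M),
    NetModule.op f ((rep M p : M →L[ℂ] M) ξ) = (rep N p : N →L[ℂ] N) (NetModule.op f ξ)
  vacuum : ∀ p : A.centralExt, rep A.vacuum p = p.1.2

open Classical in
/-- The action of the central extension on the modules of the net: the unique `ConformalAction`.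
(It exists and is unique because the universal cover of `Diff⁺(S¹)` is the colimit of its subgroups
localized in intervals; the value in the absence of one is a dummy.) -/
def NetModule.U (M : NetModule A) : A.centralExt →* unitary (M →L[ℂ] M) :=
  if h : Nonempty (ConformalAction A) then h.some.rep M else 1

/-- The unitary operator by which `g` in `PSU(1,1)~` acts on `M`. -/
def NetModule.mob (M : NetModule A) (g : MobiusCover) : unitary (M →L[ℂ] M) := M.U (A.mobius g)

theorem NetModule.mob_natural {M N : NetModule A} (f : M ⟶ N) (g : MobiusCover) (ξ : M) :
    NetModule.op f ((M.mob g : M →L[ℂ] M) ξ) = (N.mob g : N →L[ℂ] N) (NetModule.op f ξ) := by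
  unfold NetModule.mob NetModule.U
  split_ifs with h
  · exact h.some.natural f _ ξ
  · rfl

theorem ConformalNet.vacuum_mob_Ω (g : MobiusCover) :
    (A.vacuum.mob g : A.vacuum →L[ℂ] A.vacuum) A.Ω = A.Ω := by
  unfold NetModule.mob NetModule.U
  split_ifs with h
  · rw [h.some.vacuum]
    exact A.u_Ω g
  · rfl

/-! ### Smooth vectors and smooth operators -/

/-- `ξ` is in the domain of the generator `L₀` of the rotations on `M`, and `L₀ ξ = η`. -/
def NetModule.IsL0 (M : NetModule A) (ξ η : M) : Prop :=
  HasDerivAt (fun t : ℝ => (M.mob (rho t) : M →L[ℂ] M) ξ) (Complex.I • η) 0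

/-- `ξ` is in the domain of `L₀ ^ n`. -/
def NetModule.InDomL0Pow (M : NetModule A) : ℕ → M → Prop
  | 0, _ => True
  | n + 1, ξ => ∃ η, M.IsL0 ξ η ∧ M.InDomL0Pow n η

/-- The space of smooth vectors: the intersection of the domains of the powers of `L₀`. -/
def NetModule.smooth (M : NetModule A) : Submodule ℂ M where
  carrier := {ξ | ∀ n, M.InDomL0Pow n ξ}
  add_mem' := by
    have key : ∀ n (a b : M), M.InDomL0Pow n a → M.InDomL0Pow n b → M.InDomL0Pow n (a + b) := by
      intro n
      induction n with
      | zero => intros; trivial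
      | succ n ih =>
        rintro a b ⟨a', ha, ha'⟩ ⟨b', hb, hb'⟩
        refine ⟨a' + b', ?_, ih _ _ ha' hb'⟩
        have := HasDerivAt.add ha hb
        unfold NetModule.IsL0
        simp only [map_add, smul_add]
        exact this
    intro a b ha hb n
    exact key n _ _ (ha n) (hb n)
  zero_mem' := by
    have key : ∀ n, M.InDomL0Pow n 0 := by
      intro n
      induction n with
      | zero => trivial
      | succ n ih =>
        refine ⟨0, ?_, ih⟩
        unfold NetModule.IsL0
        simp only [map_zero, smul_zero]
        exact hasDerivAt_const _ _
    exact key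
  smul_mem' := by
    intro c a ha
    have key : ∀ n (a : M), M.InDomL0Pow n a → M.InDomL0Pow n (c • a) := by
      intro n
      induction n with
      | zero => intros; trivial
      | succ n ih =>
        rintro a ⟨a', ha, ha'⟩
        refine ⟨c • a', ?_, ih _ ha'⟩
        have := HasDerivAt.const_smul c ha
        unfold NetModule.IsL0
        simp only [map_smul, smul_comm Complex.I c]
        exact this
    exact fun n => key n a (ha n)

theorem NetModule.op_smooth {M N : NetModule A} (f : M ⟶ N) :
    ∀ ξ ∈ M.smooth, NetModule.op f ξ ∈ N.smooth := by
  have key : ∀ n (a : M), M.InDomL0Pow n a → N.InDomL0Pow n (NetModule.op f a) := by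
    intro n
    induction n with
    | zero => intros; trivial
    | succ n ih =>
      rintro a ⟨a', ha, ha'⟩
      refine ⟨NetModule.op f a', ?_, ih _ ha'⟩
      have := ((NetModule.op f).restrictScalars ℝ).hasFDerivAt.comp_hasDerivAt (0 : ℝ) ha
      unfold NetModule.IsL0
      simpa [Function.comp_def, NetModule.mob_natural] using this
  exact fun ξ h n => key n ξ (h n)

theorem ConformalNet.Ω_smooth : (A.Ω : A.vacuum) ∈ A.vacuum.smooth := by
  have key0 : ∀ n, A.vacuum.InDomL0Pow n (0 : A.vacuum) := fun n => zero_mem A.vacuum.smooth n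
  intro n
  cases n with
  | zero => trivial
  | succ n =>
    refine ⟨(0 : A.vacuum), ?_, key0 n⟩
    have h : (fun t : ℝ => (A.vacuum.mob (rho t) : A.vacuum →L[ℂ] A.vacuum) A.Ω)
        = fun _ => (A.Ω : A.vacuum) := funext fun t => A.vacuum_mob_Ω (rho t)
    unfold NetModule.IsL0
    rw [h, smul_zero]
    exact hasDerivAt_const _ _

/-- The vacuum vector as a smooth vector of the vacuum module. -/
def ConformalNet.Ωs (A : ConformalNet H) : A.vacuum.smooth := ⟨A.Ω, A.Ω_smooth⟩

/-- A smooth operator from `M` to `N` with domain the space of smooth vectors of `M`, together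
with its formal adjoint (the restriction of its adjoint to the smooth vectors of `N`). Both map
smooth vectors to smooth vectors. As the smooth vectors are dense, the formal adjoint is unique,
and the operator is preclosed. -/
@[ext]
structure SmoothOp (M N : NetModule A) where
  map : M.smooth →ₗ[ℂ] N.smooth
  adj : N.smooth →ₗ[ℂ] M.smooth
  inner_map : ∀ (ξ : M.smooth) (η : N.smooth), ⟪(map ξ : N), (η : N)⟫_ℂ = ⟪(ξ : M), (adj η : M)⟫_ℂ

namespace SmoothOp

/-- The composite of `S` after `T`. -/
def comp {M N K : NetModule A} (S : SmoothOp N K) (T : SmoothOp M N) : SmoothOp M K where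
  map := S.map ∘ₗ T.map
  adj := T.adj ∘ₗ S.adj
  inner_map ξ η := by simp [S.inner_map, T.inner_map]

/-- A bounded operator that is smooth, restricted to the smooth vectors. -/
def ofBounded {M N : NetModule A} (T : M →L[ℂ] N) (h : ∀ ξ ∈ M.smooth, T ξ ∈ N.smooth)
    (h' : ∀ η ∈ N.smooth, ContinuousLinearMap.adjoint T η ∈ M.smooth) : SmoothOp M N where
  map := (T : M →ₗ[ℂ] N).restrict h
  adj := ((ContinuousLinearMap.adjoint T : N →L[ℂ] M) : N →ₗ[ℂ] M).restrict h'
  inner_map ξ η := (ContinuousLinearMap.adjoint_inner_right T ξ.1 η.1).symm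

/-- A homomorphism of modules as a smooth operator. -/
def ofHom {M N : NetModule A} (f : M ⟶ N) : SmoothOp M N :=
  ofBounded (NetModule.op f) (NetModule.op_smooth f) (NetModule.op_smooth (NetModule.adj f))

/-- Adjoint commutativity of the square with left side `a`, right side `b`, top `c`,
bottom `d`. -/
def CommutesAdjointly {M N K L : NetModule A} (a : SmoothOp M K) (b : SmoothOp N L)
    (c : SmoothOp M N) (d : SmoothOp K L) : Prop :=
  d.map ∘ₗ a.map = b.map ∘ₗ c.map ∧ c.map ∘ₗ a.adj = b.adj ∘ₗ d.map

end SmoothOp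

/-- Quasi-rotation invariance of a dense subspace of the smooth vectors. -/
def NetModule.IsDenseQRI (M : NetModule A) (D : Submodule ℂ M) : Prop :=
  D ≤ M.smooth ∧ Dense (D : Set M) ∧ ∃ δ > (0 : ℝ), ∃ D' : Submodule ℂ M, D' ≤ D ∧
    Dense (D' : Set M) ∧ ∀ t : ℝ, |t| < δ → ∀ ξ ∈ D', (M.mob (rho t) : M →L[ℂ] M) ξ ∈ D

/-- `T` is localizable: every dense quasi-rotation invariant subspace is a core, i.e. the graph of
the restriction of `T` to it is dense in the graph of `T`. -/
def SmoothOp.IsLocalizable {M N : NetModule A} (T : SmoothOp M N) : Prop :=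
  ∀ D : Submodule ℂ M, M.IsDenseQRI D → ∀ ξ : M.smooth,
    ((ξ : M), (T.map ξ : N)) ∈ closure {p : M × N | ∃ ζ : M.smooth, (ζ : M) ∈ D ∧
      p = ((ζ : M), (T.map ζ : N))}

/-- The elements of the local algebra that act smoothly, together with their adjoints, on every
module. -/
def ConformalNet.IsSmoothElt (A : ConformalNet H) (I : Arc) (x : A.loc I) : Prop :=
  ∀ M : NetModule A, (∀ ξ ∈ M.smooth, M.rep I x ξ ∈ M.smooth) ∧
    (∀ ξ ∈ M.smooth, ContinuousLinearMap.adjoint (M.rep I x) ξ ∈ M.smooth)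

/-- The smooth operator on `M` given by a smooth element of a local algebra. -/
def ConformalNet.IsSmoothElt.onModule {I : Arc} {x : A.loc I} (h : A.IsSmoothElt I x)
    (M : NetModule A) : SmoothOp M M :=
  SmoothOp.ofBounded (M.rep I x) (h M).1 (h M).2

/-! ### Braided C*-tensor categories of modules -/

/-- The adjoint of a morphism in a full subcategory of the category of modules. -/
def dag {P : ObjectProperty (NetModule A)} {X Y : P.FullSubcategory} (f : X ⟶ Y) : Y ⟶ X :=
  ObjectProperty.homMk (NetModule.adj f.hom)

/-- The bounded operator underlying a morphism in a full subcategory. -/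
def opOf {P : ObjectProperty (NetModule A)} {X Y : P.FullSubcategory} (f : X ⟶ Y) :
    X.obj →L[ℂ] Y.obj := NetModule.op f.hom

/-- The smooth operator underlying a morphism in a full subcategory. -/
def smoothOf {P : ObjectProperty (NetModule A)} {X Y : P.FullSubcategory} (f : X ⟶ Y) :
    SmoothOp X.obj Y.obj := SmoothOp.ofHom f.hom

/-- A full abelian subcategory of the modules of the net, containing the vacuum module, with the
structure of a braided C*-tensor category whose unit object is the vacuum module (identified with
the unit by a unitary `unitIso`). -/
structure BraidedModuleCategory (A : ConformalNet H) where
  mem : ObjectProperty (NetModule A)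
  vac_mem : mem A.vacuum
  /-- closed under submodules, up to unitary equivalence -/
  exists_sub : ∀ (X : mem.FullSubcategory) (K : Submodule ℂ X.obj),
    IsClosed (K : Set X.obj) → (∀ (I : Arc) (x : A.loc I), ∀ ξ ∈ K, X.obj.rep I x ξ ∈ K) →
      ∃ (Y : mem.FullSubcategory) (v : Y ⟶ X), v ≫ dag v = 𝟙 Y ∧ Set.range (opOf v) = K
  /-- closed under direct sums, up to unitary equivalence -/
  exists_sum : ∀ X Y : mem.FullSubcategory, ∃ (Z : mem.FullSubcategory) (v : X ⟶ Z) (w : Y ⟶ Z),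
    v ≫ dag v = 𝟙 X ∧ w ≫ dag w = 𝟙 Y ∧
      ∀ ζ : Z.obj, opOf v (opOf (dag v) ζ) + opOf w (opOf (dag w) ζ) = ζ
  [monoidal : MonoidalCategory mem.FullSubcategory]
  [braided : BraidedCategory mem.FullSubcategory]
  unitIso : (⟨A.vacuum, vac_mem⟩ : mem.FullSubcategory) ≅ 𝟙_ mem.FullSubcategory
  unitIso_unitary : unitIso.inv = dag unitIso.hom
  /- The tensor product is bilinear on morphisms and compatible with adjoints. -/
  whiskerRight_add : ∀ {X Y : mem.FullSubcategory} (f g h : X ⟶ Y) (Z : mem.FullSubcategory),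
    opOf h = opOf f + opOf g → opOf (h ▷ Z) = opOf (f ▷ Z) + opOf (g ▷ Z)
  whiskerLeft_add : ∀ {X Y : mem.FullSubcategory} (f g h : X ⟶ Y) (Z : mem.FullSubcategory),
    opOf h = opOf f + opOf g → opOf (Z ◁ h) = opOf (Z ◁ f) + opOf (Z ◁ g)
  whiskerRight_smul : ∀ {X Y : mem.FullSubcategory} (c : ℂ) (f h : X ⟶ Y)
    (Z : mem.FullSubcategory), opOf h = c • opOf f → opOf (h ▷ Z) = c • opOf (f ▷ Z)
  whiskerLeft_smul : ∀ {X Y : mem.FullSubcategory} (c : ℂ) (f h : X ⟶ Y)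
    (Z : mem.FullSubcategory), opOf h = c • opOf f → opOf (Z ◁ h) = c • opOf (Z ◁ f)
  dag_whiskerRight : ∀ {X Y : mem.FullSubcategory} (f : X ⟶ Y) (Z : mem.FullSubcategory),
    dag (f ▷ Z) = dag f ▷ Z
  dag_whiskerLeft : ∀ {X Y : mem.FullSubcategory} (f : X ⟶ Y) (Z : mem.FullSubcategory),
    dag (Z ◁ f) = Z ◁ dag f
  /- The associator, the unitors and the braiding are unitary. -/
  associator_unitary : ∀ X Y Z : mem.FullSubcategory, (α_ X Y Z).inv = dag (α_ X Y Z).hom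
  leftUnitor_unitary : ∀ X : mem.FullSubcategory, (λ_ X).inv = dag (λ_ X).hom
  rightUnitor_unitary : ∀ X : mem.FullSubcategory, (ρ_ X).inv = dag (ρ_ X).hom
  braiding_unitary : ∀ X Y : mem.FullSubcategory, (β_ X Y).inv = dag (β_ X Y).hom

attribute [instance] BraidedModuleCategory.monoidal BraidedModuleCategory.braided

namespace BraidedModuleCategory

variable (C : BraidedModuleCategory A)

/-- The objects of the category. -/
abbrev Obj : Type (u + 1) := C.mem.FullSubcategory

/-- The vacuum module as an object. -/
abbrev vac : C.Obj := ⟨A.vacuum, C.vac_mem⟩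

/-- The identification of `X ⊗ H₀` with `X`. -/
def rightId (X : C.Obj) : X ⊗ C.vac ⟶ X := (X ◁ C.unitIso.hom) ≫ (ρ_ X).hom

/-- The identification of `H₀ ⊗ X` with `X`. -/
def leftId (X : C.Obj) : C.vac ⊗ X ⟶ X := (C.unitIso.hom ▷ X) ≫ (λ_ X).hom

/-- Every object is unitarily equivalent to a finite direct sum of irreducible objects. -/
def IsSemisimple : Prop :=
  ∀ X : C.Obj, ∃ (n : ℕ) (Y : Fin n → C.Obj) (v : ∀ k, Y k ⟶ X),
    (∀ k, (Y k).obj.IsIrreducible ∧ v k ≫ dag (v k) = 𝟙 (Y k)) ∧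
      ∀ ξ : X.obj, ∑ k, opOf (v k) (opOf (dag (v k)) ξ) = ξ

/-- The tensor product of a nonempty list of objects. -/
def tensorList (X : C.Obj) : List C.Obj → C.Obj
  | [] => X
  | Y :: l => X ⊗ tensorList Y l

/-- `F` generates the category: every irreducible object is equivalent to a submodule of a tensor
product of a (nonempty, finite) sequence of elements of `F`. -/
def Generates (F : Set C.Obj) : Prop :=
  ∀ X : C.Obj, X.obj.IsIrreducible → ∃ Y ∈ F, ∃ l : List C.Obj, (∀ Z ∈ l, Z ∈ F) ∧
    ∃ v : X ⟶ C.tensorList Y l, v ≫ dag v = 𝟙 X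

end BraidedModuleCategory

/-! ### Weak categorical (local) extensions -/

/-- The data of charged fields: for each object `i` in `F` and each arg-valued interval `I` a set
`charges i I` of labels, monotone in `I`, and for each label and each object `k` of the category
smooth operators `L : k → i ⊗ k` and `R : k → k ⊗ i`. -/
structure FieldSystem (C : BraidedModuleCategory A) (F : Set C.Obj) where
  Label : F → Type w
  charges : ∀ i : F, ArgInterval → Set (Label i)
  mono : ∀ {i : F} {I J : ArgInterval}, I ≤ J → ∀ {a}, a ∈ charges i I → a ∈ charges i J
  L : ∀ {i : F} (I : ArgInterval), charges i I → ∀ k : C.Obj, SmoothOp k.obj (i.1 ⊗ k).obj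
  R : ∀ {i : F} (I : ArgInterval), charges i I → ∀ k : C.Obj, SmoothOp k.obj (k ⊗ i.1).obj

namespace FieldSystem

variable {C : BraidedModuleCategory A} {F : Set C.Obj}

/-- Covariance of the fields under `g` in `PSU(1,1)~`: for every label `a` at `I` there is a label
`b` at `g I` with `L(b) η = g L(a) g⁻¹ η` and `R(b) η = g R(a) g⁻¹ η` for all smooth vectors `η`
of all objects. -/
def CovariantUnder (E : FieldSystem.{u, w} C F) (g : MobiusCover) : Prop :=
  ∀ (i : F) (I : ArgInterval) (a : E.charges i I), ∃ b : E.charges i (g.1.act I),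
    ∀ (l : C.Obj) (η : l.obj.smooth),
      ∃ h : ((star (l.obj.mob g) : unitary (l.obj →L[ℂ] l.obj)) : l.obj →L[ℂ] l.obj) η.1
          ∈ l.obj.smooth,
        ((E.L _ b l).map η : (i.1 ⊗ l).obj) =
            ((i.1 ⊗ l).obj.mob g : (i.1 ⊗ l).obj →L[ℂ] (i.1 ⊗ l).obj) ((E.L I a l).map ⟨_, h⟩) ∧
        ((E.R _ b l).map η : (l ⊗ i.1).obj) =
            ((l ⊗ i.1).obj.mob g : (l ⊗ i.1).obj →L[ℂ] (l ⊗ i.1).obj) ((E.R I a l).map ⟨_, h⟩)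

/-- Möbius covariance. -/
def IsMobiusCovariant (E : FieldSystem.{u, w} C F) : Prop := ∀ g, E.CovariantUnder g

/-- A word `(aₙ, …, a₁)`, `n ≥ 1`, of labels at `I`. -/
inductive Word (E : FieldSystem.{u, w} C F) (I : ArgInterval) : Type (max (u + 1) w)
  | single (i : F) (a : E.charges i I) : Word E I
  | cons (i : F) (a : E.charges i I) (s : Word E I) : Word E I

namespace Word

variable {E : FieldSystem.{u, w} C F} {I : ArgInterval}

/-- The tensor product `iₙ ⊗ ⋯ ⊗ i₁` of the charges of a word. -/
def obj : Word E I → C.Obj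
  | single i _ => i.1
  | cons i _ s => i.1 ⊗ s.obj

/-- The product `L(aₙ) ⋯ L(a₁)` on `k`, as an operator from `k` to `(iₙ ⊗ ⋯ ⊗ i₁) ⊗ k`. -/
def left : ∀ (s : Word E I) (k : C.Obj), SmoothOp k.obj (s.obj ⊗ k).obj
  | single _ a, k => E.L I a k
  | cons i a s, k => (smoothOf (α_ i.1 s.obj k).inv).comp ((E.L I a (s.obj ⊗ k)).comp (left s k))

/-- The product `R(a₁) ⋯ R(aₙ)` on `k`, as an operator from `k` to `k ⊗ (iₙ ⊗ ⋯ ⊗ i₁)`. -/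
def right : ∀ (s : Word E I) (k : C.Obj), SmoothOp k.obj (k ⊗ s.obj).obj
  | single _ a, k => E.R I a k
  | cons i a s, k => (smoothOf (α_ k i.1 s.obj).hom).comp ((right s (k ⊗ i.1)).comp (E.R I a k))

/-- The letters of the word are localized in intervals `Iₙ, …, I₁` contained in `J`, each
anticlockwise to all those that follow. -/
def IsOrdered : Word E I → ArgInterval → Prop
  | single i a, J => a.1 ∈ E.charges i J
  | cons i a s, J => ∃ J₁ J₂ : ArgInterval, J₁ ≤ J ∧ J₂ ≤ J ∧ J₁.Anticlockwise J₂ ∧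
      a.1 ∈ E.charges i J₁ ∧ s.IsOrdered J₂

end Word

/-- The axioms of a weak categorical extension, required of fields for the objects in `F` only. A
weak categorical extension is the case where `F` is the class of all objects. -/
structure IsWeakExtension (E : FieldSystem.{u, w} C F) : Prop where
  L_localizable : ∀ {i : F} (I : ArgInterval) (a : E.charges i I) (k : C.Obj),
    (E.L I a k).IsLocalizable
  R_localizable : ∀ {i : F} (I : ArgInterval) (a : E.charges i I) (k : C.Obj),
    (E.R I a k).IsLocalizable
  isotony : ∀ {i : F} {I J : ArgInterval} (h : I ≤ J) (a : E.charges i I) (k : C.Obj),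
    E.L I a k = E.L J ⟨a.1, E.mono h a.2⟩ k ∧ E.R I a k = E.R J ⟨a.1, E.mono h a.2⟩ k
  functoriality : ∀ {i : F} (I : ArgInterval) (a : E.charges i I) {k k' : C.Obj} (f : k ⟶ k'),
    (smoothOf (i.1 ◁ f)).map ∘ₗ (E.L I a k).map = (E.L I a k').map ∘ₗ (smoothOf f).map ∧
    (smoothOf (f ▷ i.1)).map ∘ₗ (E.R I a k).map = (E.R I a k').map ∘ₗ (smoothOf f).map
  neutrality : ∀ {i : F} (I : ArgInterval) (a : E.charges i I),
    (smoothOf (C.rightId i.1)).map ∘ₗ (E.L I a C.vac).map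
      = (smoothOf (C.leftId i.1)).map ∘ₗ (E.R I a C.vac).map
  reeh_schlieder : ∀ (i : F) (I : ArgInterval),
    Dense (Submodule.span ℂ {ξ : i.1.obj | ∃ a : E.charges i I,
      ξ = opOf (C.rightId i.1) ((E.L I a C.vac).map A.Ωs)} : Set i.1.obj)
  density_L : ∀ (i : F) (I : ArgInterval) (k : C.Obj),
    Dense (Submodule.span ℂ {ξ : (i.1 ⊗ k).obj | ∃ (a : E.charges i I) (χ : k.obj.smooth),
      ξ = (E.L I a k).map χ} : Set (i.1 ⊗ k).obj)
  density_R : ∀ (i : F) (I : ArgInterval) (k : C.Obj),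
    Dense (Submodule.span ℂ {ξ : (k ⊗ i.1).obj | ∃ (a : E.charges i I) (χ : k.obj.smooth),
      ξ = (E.R I a k).map χ} : Set (k ⊗ i.1).obj)
  intertwining : ∀ {i : F} (I : ArgInterval) (a : E.charges i I) (k : C.Obj)
    (x : A.loc I.compl.toArc) (hx : A.IsSmoothElt I.compl.toArc x),
    SmoothOp.CommutesAdjointly (E.L I a k) (E.L I a k) (hx.onModule k.obj)
      (hx.onModule (i.1 ⊗ k).obj) ∧
    SmoothOp.CommutesAdjointly (hx.onModule k.obj) (hx.onModule (k ⊗ i.1).obj)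
      (E.R I a k) (E.R I a k)
  weak_locality : ∀ {i j : F} (I J : ArgInterval), I.Anticlockwise J →
    ∀ (a : E.charges i I) (b : E.charges j J) (k : C.Obj),
      SmoothOp.CommutesAdjointly (E.L I a k) (E.L I a (k ⊗ j.1)) (E.R J b k)
        ((smoothOf (α_ i.1 k j.1).hom).comp (E.R J b (i.1 ⊗ k)))
  braiding : ∀ {i : F} (I : ArgInterval) (a : E.charges i I) (k : C.Obj),
    (smoothOf (β_ i.1 k).hom).map ∘ₗ (E.L I a k).map = (E.R I a k).map
  rotation_covariance : ∀ t : ℝ, E.CovariantUnder (rho t)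

/-- A weak categorical local extension with fields for the objects in `F`. -/
structure IsWeakLocalExtension (E : FieldSystem.{u, w} C F) : Prop extends E.IsWeakExtension where
  products_localizable : ∀ {I : ArgInterval} (s : Word E I) (k : C.Obj),
    (s.left k).IsLocalizable

/-- `E'`, with fields for all objects, extends `E`: the labels of `E` are labels of `E'` for the
same intervals and with the same operators. -/
def Extends (E' : FieldSystem.{u, max (u + 1) w} C Set.univ) (E : FieldSystem.{u, w} C F) : Prop :=
  ∃ ι : ∀ i : F, E.Label i → E'.Label ⟨i.1, trivial⟩,
    (∀ i, Function.Injective (ι i)) ∧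
    ∃ hι : ∀ (i : F) (I : ArgInterval) (a : E.charges i I),
        ι i a.1 ∈ E'.charges ⟨i.1, trivial⟩ I,
      ∀ (i : F) (I : ArgInterval) (a : E.charges i I) (k : C.Obj),
        E'.L I ⟨ι i a.1, hι i I a⟩ k = E.L I a k ∧ E'.R I ⟨ι i a.1, hι i I a⟩ k = E.R I a k

/-- The field of `E'` with charge `X` and label `a` at `I` is the product of the fields of `E` in
the word `s`, composed with the morphism `G`:
`L(a) = (G ⊗ 1) L(aₙ) ⋯ L(a₁)` and `R(a) = (1 ⊗ G) R(a₁) ⋯ R(aₙ)`. -/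
def IsComposite {E' : FieldSystem.{u, max (u + 1) w} C Set.univ} {E : FieldSystem.{u, w} C F}
    {X : C.Obj} {I : ArgInterval} (a : E'.charges ⟨X, trivial⟩ I) (s : Word E I)
    (G : s.obj ⟶ X) : Prop :=
  ∀ k : C.Obj, E'.L I a k = (smoothOf (G ▷ k)).comp (s.left k) ∧
    E'.R I a k = (smoothOf (k ◁ G)).comp (s.right k)

/-- The fields of `E'` are exactly the products of fields of `E`, with letters localized in
anticlockwise order, composed with morphisms. -/
def IsBuiltFrom (E' : FieldSystem.{u, max (u + 1) w} C Set.univ) (E : FieldSystem.{u, w} C F) :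
    Prop :=
  ∀ (X : C.Obj) (I : ArgInterval),
    (∀ a : E'.charges ⟨X, trivial⟩ I, ∃ s : Word E I, s.IsOrdered I ∧ ∃ G : s.obj ⟶ X,
      IsComposite a s G) ∧
    (∀ s : Word E I, s.IsOrdered I → ∀ G : s.obj ⟶ X, ∃ a : E'.charges ⟨X, trivial⟩ I,
      IsComposite a s G)

end FieldSystem

end Modules

end

/-!
The fields of the extension are taken to be the operators
`(G ⊗ 1) L(aₙ) ⋯ L(a₁)` and `(1 ⊗ G) R(a₁) ⋯ R(aₙ)` themselves. With `FieldPair.mul` and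
`FieldPair.post` for the two operations involved, these pairs form the smallest class
(`FieldSystem.OrderedProduct`) that contains the given fields and is closed under morphisms and
under multiplication on the left by a given field localized anticlockwise to the product. So each
algebraic axiom only has to be checked for these two operations.

Functoriality, intertwining and covariance pass to products at once. Weak locality follows by
pasting adjointly commuting squares, the coherence being the pentagon axiom
(`FieldPair.IsLocalTo.mul_left`, `FieldPair.IsLocalTo.mul_right`). For the braiding axiom the
hexagon moves the factors of a product past `k` one after the other, and weak locality of the
factors restores their order (`FieldPair.IsBraided.mul`); this is where the anticlockwise order is
needed. Neutrality, and the statements on `R` that concern domains or density, follow from the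
braiding axiom, as `R` is `L` composed with a unitary. Localizability of products of the new
fields reduces to that of products of the old ones, because a product of words is a word up to
morphisms, which are bounded (`FieldSystem.IsWeakExtension.exists_word_mul`).

The Reeh-Schlieder and density axioms are analytic. The vectors `L(aₙ) ⋯ L(a₁) χ` with the letters
ordered in `J` span a quasi-rotation invariant space: those with letters in a smaller interval stay
in it under small rotations. If it is dense, it is therefore a core for the localizable operators
`L(a)`, and applying these to it gives a dense space again
(`FieldSystem.dense_productSpan_tensor`). This gives density for all tensor products of objects of
`F`; irreducible objects are retracts of these, and all objects are finite direct sums of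
irreducible ones (`FieldSystem.dense_productSpan`).
-/

noncomputable section

/-! ### Arg-valued intervals -/

namespace ArgInterval

theorem le_iff {I J : ArgInterval} : I ≤ J ↔ J.lo ≤ I.lo ∧ I.hi ≤ J.hi :=
  Set.Ioo_subset_Ioo_iff I.lo_lt

theorem le_refl (I : ArgInterval) : I ≤ I := Set.Subset.refl _

theorem le_trans {I J K : ArgInterval} (h : I ≤ J) (h' : J ≤ K) : I ≤ K := Set.Subset.trans h h'

theorem Anticlockwise.mono {I I' J J' : ArgInterval} (h : I.Anticlockwise J) (hI : I' ≤ I)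
    (hJ : J' ≤ J) : I'.Anticlockwise J' := fun x hx y hy => h x (hI hx) y (hJ hy)

/-- The interval with an amount `ε` cut off at both ends. -/
def shrink (J : ArgInterval) (ε : ℝ) (h0 : 0 < ε) (h : 2 * ε < J.hi - J.lo) : ArgInterval :=
  ⟨J.lo + ε, J.hi - ε, by linarith, by linarith [J.hi_lt]⟩

theorem act_rot_shrink_le {J : ArgInterval} {ε : ℝ} (h0 : 0 < ε) (h : 2 * ε < J.hi - J.lo)
    {t : ℝ} (ht : |t| < ε) : (CircleDiff.rot t).act (J.shrink ε h0 h) ≤ J := by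
  rw [le_iff]
  change J.lo ≤ J.lo + ε + t ∧ J.hi - ε + t ≤ J.hi
  have := abs_lt.1 ht
  constructor <;> linarith

theorem shrink_le {J : ArgInterval} {ε : ℝ} (h0 : 0 < ε) (h : 2 * ε < J.hi - J.lo) :
    J.shrink ε h0 h ≤ J := by
  rw [le_iff]
  change J.lo ≤ J.lo + ε ∧ J.hi - ε ≤ J.hi
  constructor <;> linarith

/-- The upper and the lower half of an interval. -/
theorem exists_halves (J : ArgInterval) :
    ∃ J₁ J₂ : ArgInterval, J₁ ≤ J ∧ J₂ ≤ J ∧ J₁.Anticlockwise J₂ := by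
  have h1 := J.lo_lt
  have h2 := J.hi_lt
  refine ⟨⟨(J.lo + J.hi) / 2, J.hi, by linarith, by linarith⟩,
    ⟨J.lo, (J.lo + J.hi) / 2, by linarith, by linarith⟩, ?_, ?_, ?_⟩
  · exact le_iff.2 ⟨by simp only; linarith, le_rfl⟩
  · exact le_iff.2 ⟨le_rfl, by simp only; linarith⟩
  · rintro x ⟨hx1, hx2⟩ y ⟨hy1, hy2⟩
    simp only at hx1 hx2 hy1 hy2
    constructor <;> linarith

theorem act_le (φ : CircleDiff) {I J : ArgInterval} (h : I ≤ J) : φ.act I ≤ φ.act J := by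
  rw [le_iff] at *
  exact ⟨φ.2.2.2.1.monotone h.1, φ.2.2.2.1.monotone h.2⟩

theorem Anticlockwise.act (φ : CircleDiff) {I J : ArgInterval} (h : I.Anticlockwise J) :
    (φ.act I).Anticlockwise (φ.act J) := by
  intro x hx y hy
  obtain ⟨x, rfl⟩ := φ.1.surjective x
  obtain ⟨y, rfl⟩ := φ.1.surjective y
  have hm : StrictMono φ.1.1 := φ.2.2.2.1
  obtain ⟨h1, h2⟩ := h x ⟨hm.lt_iff_lt.1 hx.1, hm.lt_iff_lt.1 hx.2⟩ y
    ⟨hm.lt_iff_lt.1 hy.1, hm.lt_iff_lt.1 hy.2⟩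
  refine ⟨hm h1, ?_⟩
  have := hm h2
  exact this.trans_eq (φ.2.2.2.2 y)

end ArgInterval

section Fields

variable {H : Type u} [NormedAddCommGroup H] [InnerProductSpace ℂ H]
    [CompleteSpace H] [TopologicalSpace.SeparableSpace H] {A : ConformalNet H}

local infixr:80 " ⊚ " => SmoothOp.comp

/-! ### Calculus of smooth operators -/

namespace SmoothOp

/-- The adjoint takes values in the smooth vectors, so that it is already determined by the
pairing with smooth vectors: density of the latter plays no role. -/
theorem ext_map {M N : NetModule A} {S T : SmoothOp M N} (h : S.map = T.map) : S = T := by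
  refine SmoothOp.ext h (LinearMap.ext fun η => Subtype.ext ?_)
  have h1 : ∀ ξ : M.smooth, ⟪(ξ : M), ((S.adj η - T.adj η : M.smooth) : M)⟫_ℂ = 0 := fun ξ => by
    rw [Submodule.coe_sub, inner_sub_right, ← S.inner_map, ← T.inner_map, h, sub_self]
  have h2 := inner_self_eq_zero.1 (h1 (S.adj η - T.adj η))
  rwa [Submodule.coe_sub, sub_eq_zero] at h2

/-- The formal adjoint. -/
def dagger {M N : NetModule A} (T : SmoothOp M N) : SmoothOp N M where
  map := T.adj
  adj := T.map
  inner_map ξ η := by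
    rw [← inner_conj_symm, ← T.inner_map, inner_conj_symm]

theorem comp_assoc {M N K K' : NetModule A} (S : SmoothOp K K') (T : SmoothOp N K)
    (R : SmoothOp M N) : (S ⊚ T) ⊚ R = S ⊚ T ⊚ R := rfl

theorem dagger_comp {M N K : NetModule A} (S : SmoothOp N K) (T : SmoothOp M N) :
    (S ⊚ T).dagger = T.dagger ⊚ S.dagger := rfl

theorem commutesAdjointly_iff {M N K K' : NetModule A} {a : SmoothOp M K} {b : SmoothOp N K'}
    {c : SmoothOp M N} {d : SmoothOp K K'} :
    CommutesAdjointly a b c d ↔ d ⊚ a = b ⊚ c ∧ c ⊚ a.dagger = b.dagger ⊚ d :=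
  ⟨fun h => ⟨ext_map h.1, ext_map h.2⟩, fun h => ⟨congrArg map h.1, congrArg map h.2⟩⟩

theorem comp_eq_of_dagger {M N K K' : NetModule A} {a : SmoothOp M K} {b : SmoothOp N K'}
    {c : SmoothOp M N} {d : SmoothOp K K'} (h : a ⊚ c.dagger = d.dagger ⊚ b) :
    c ⊚ a.dagger = b.dagger ⊚ d := congrArg dagger h

namespace CommutesAdjointly

variable {M N K K' : NetModule A} {a : SmoothOp M K} {b : SmoothOp N K'}
    {c : SmoothOp M N} {d : SmoothOp K K'}

theorem vcomp {P Q : NetModule A} {a' : SmoothOp K P} {b' : SmoothOp K' Q} {e : SmoothOp P Q}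
    (h : CommutesAdjointly a b c d) (h' : CommutesAdjointly a' b' d e) :
    CommutesAdjointly (a' ⊚ a) (b' ⊚ b) c e := by
  rw [commutesAdjointly_iff] at *
  constructor
  · rw [← comp_assoc, h'.1, comp_assoc, h.1, comp_assoc]
  · rw [dagger_comp, dagger_comp, ← comp_assoc, h.2, comp_assoc, h'.2, comp_assoc]

theorem hcomp {P Q : NetModule A} {c' : SmoothOp N P} {d' : SmoothOp K' Q} {e : SmoothOp P Q}
    (h : CommutesAdjointly a b c d) (h' : CommutesAdjointly b e c' d') :
    CommutesAdjointly a e (c' ⊚ c) (d' ⊚ d) := by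
  rw [commutesAdjointly_iff] at *
  constructor
  · rw [comp_assoc, h.1, ← comp_assoc, h'.1, comp_assoc]
  · rw [comp_assoc, h.2, ← comp_assoc, h'.2, comp_assoc]

end CommutesAdjointly

/-- Localizability survives composition with a bounded operator on the left. -/
theorem IsLocalizable.hom_comp {M N K : NetModule A} {T : SmoothOp M N} (h : T.IsLocalizable)
    (f : N ⟶ K) : (ofHom f ⊚ T).IsLocalizable := by
  intro D hD ξ
  have hc : Continuous fun p : M × N => (p.1, NetModule.op f p.2) := by fun_prop
  refine closure_mono ?_ (image_closure_subset_closure_image hc ⟨_, h D hD ξ, rfl⟩)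
  rintro _ ⟨_, ⟨ζ, hζ, rfl⟩, rfl⟩
  exact ⟨ζ, hζ, rfl⟩

end SmoothOp

/-! ### Morphisms as smooth operators -/

section Morphisms

variable {C : BraidedModuleCategory A} {X Y Z : C.Obj} {M N : NetModule A}

theorem smoothOf_comp (f : X ⟶ Y) (g : Y ⟶ Z) :
    smoothOf (f ≫ g) = smoothOf g ⊚ smoothOf f := SmoothOp.ext_map rfl

theorem smoothOf_id_comp (T : SmoothOp M X.obj) : smoothOf (𝟙 X) ⊚ T = T :=
  SmoothOp.ext_map rfl

theorem comp_smoothOf_id (T : SmoothOp X.obj M) : T ⊚ smoothOf (𝟙 X) = T :=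
  SmoothOp.ext_map rfl

theorem smoothOf_comp_comp (f : X ⟶ Y) (g : Y ⟶ Z) (T : SmoothOp M X.obj) :
    smoothOf g ⊚ smoothOf f ⊚ T = smoothOf (f ≫ g) ⊚ T := by
  rw [smoothOf_comp, SmoothOp.comp_assoc]

theorem smoothOf_dagger (f : X ⟶ Y) : (smoothOf f).dagger = smoothOf (dag f) :=
  SmoothOp.ext_map rfl

theorem dag_dag (f : X ⟶ Y) : dag (dag f) = f :=
  InducedCategory.hom_ext (NetHom.ext (ContinuousLinearMap.adjoint_adjoint (opOf f)))

theorem opOf_comp (f : X ⟶ Y) (g : Y ⟶ Z) (ξ : X.obj) :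
    opOf (f ≫ g) ξ = opOf g (opOf f ξ) := rfl

theorem opOf_iso_hom_inv (e : X ≅ Y) (ξ : X.obj) : opOf e.inv (opOf e.hom ξ) = ξ := by
  rw [← opOf_comp, e.hom_inv_id]; rfl

theorem opOf_iso_inv_hom (e : X ≅ Y) (ξ : Y.obj) : opOf e.hom (opOf e.inv ξ) = ξ := by
  rw [← opOf_comp, e.inv_hom_id]; rfl

/-- For unitary isomorphisms as vertical sides, commutativity is adjoint commutativity. -/
theorem commutesAdjointly_of_unitary {X' Y' : C.Obj} (e : X ≅ Y) (e' : X' ≅ Y')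
    (he : e.inv = dag e.hom) (he' : e'.inv = dag e'.hom) {c : SmoothOp X.obj X'.obj}
    {d : SmoothOp Y.obj Y'.obj} (h : d ⊚ smoothOf e.hom = smoothOf e'.hom ⊚ c) :
    SmoothOp.CommutesAdjointly (smoothOf e.hom) (smoothOf e'.hom) c d := by
  refine SmoothOp.commutesAdjointly_iff.2 ⟨h, ?_⟩
  rw [smoothOf_dagger, smoothOf_dagger, ← he, ← he']
  have h1 := congrArg (fun T => smoothOf e'.inv ⊚ T ⊚ smoothOf e.inv) h
  simp only [SmoothOp.comp_assoc, smoothOf_comp_comp, ← smoothOf_comp, e.inv_hom_id,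
    e'.hom_inv_id, comp_smoothOf_id, smoothOf_id_comp] at h1
  exact h1.symm

end Morphisms

/-! ### Fields of a given charge -/

/-- The operators of a single charged field of charge `X`: a family of smooth operators
`L : k → X ⊗ k` and a family of smooth operators `R : k → k ⊗ X`. -/
@[ext]
structure FieldPair {C : BraidedModuleCategory A} (X : C.Obj) where
  L : ∀ k : C.Obj, SmoothOp k.obj (X ⊗ k).obj
  R : ∀ k : C.Obj, SmoothOp k.obj (k ⊗ X).obj

namespace FieldPair

variable {C : BraidedModuleCategory A} {X Y Z : C.Obj}

/-- Composition of a field with a morphism out of its charge. -/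
def post (T : FieldPair X) (G : X ⟶ Y) : FieldPair Y where
  L k := smoothOf (G ▷ k) ⊚ T.L k
  R k := smoothOf (k ◁ G) ⊚ T.R k

/-- The product of two fields, in the order `L(T) L(S)` and `R(S) R(T)`. -/
def mul (T : FieldPair X) (S : FieldPair Y) : FieldPair (X ⊗ Y) where
  L k := smoothOf (α_ X Y k).inv ⊚ T.L (Y ⊗ k) ⊚ S.L k
  R k := smoothOf (α_ k X Y).hom ⊚ S.R (k ⊗ X) ⊚ T.R k

/-- The operators intertwine the actions of morphisms. -/
def IsNatural (T : FieldPair X) : Prop :=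
  ∀ {k k' : C.Obj} (f : k ⟶ k'), smoothOf (X ◁ f) ⊚ T.L k = T.L k' ⊚ smoothOf f ∧
    smoothOf (f ▷ X) ⊚ T.R k = T.R k' ⊚ smoothOf f

/-- `L(T)` and `R(S)` commute adjointly. -/
def IsLocalTo (T : FieldPair X) (S : FieldPair Y) : Prop :=
  ∀ k : C.Obj, SmoothOp.CommutesAdjointly (T.L k) (T.L (k ⊗ Y)) (S.R k)
    (smoothOf (α_ X k Y).hom ⊚ S.R (X ⊗ k))

/-- The braiding carries `L(T)` to `R(T)`. -/
def IsBraided (T : FieldPair X) : Prop :=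
  ∀ k : C.Obj, smoothOf (β_ X k).hom ⊚ T.L k = T.R k

/-- `T` commutes adjointly with the smooth element `x` of a local algebra. -/
def CommutesWith (T : FieldPair X) {I : Arc} {x : A.loc I} (hx : A.IsSmoothElt I x) : Prop :=
  ∀ k : C.Obj, SmoothOp.CommutesAdjointly (T.L k) (T.L k) (hx.onModule k.obj)
      (hx.onModule (X ⊗ k).obj) ∧
    SmoothOp.CommutesAdjointly (hx.onModule k.obj) (hx.onModule (k ⊗ X).obj) (T.R k) (T.R k)

/-- `T'` is the conjugate of `T` by the element `g` of `PSU(1,1)~`. -/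
def IsConj (g : MobiusCover) (T T' : FieldPair X) : Prop :=
  ∀ (l : C.Obj) (η : l.obj.smooth),
    ∃ h : ((star (l.obj.mob g) : unitary (l.obj →L[ℂ] l.obj)) : l.obj →L[ℂ] l.obj) η.1
        ∈ l.obj.smooth,
      ((T'.L l).map η : (X ⊗ l).obj) =
          ((X ⊗ l).obj.mob g : (X ⊗ l).obj →L[ℂ] (X ⊗ l).obj) ((T.L l).map ⟨_, h⟩) ∧
      ((T'.R l).map η : (l ⊗ X).obj) =
          ((l ⊗ X).obj.mob g : (l ⊗ X).obj →L[ℂ] (l ⊗ X).obj) ((T.R l).map ⟨_, h⟩)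

theorem post_id (T : FieldPair X) : T.post (𝟙 X) = T := by
  ext1 <;> funext k <;> simp [post, smoothOf_id_comp]

theorem post_post (T : FieldPair X) (G : X ⟶ Y) (G' : Y ⟶ Z) :
    (T.post G).post G' = T.post (G ≫ G') := by
  ext1 <;> funext k <;> simp [post, smoothOf_comp_comp]

theorem post_mul {W : C.Obj} (T : FieldPair X) (G : X ⟶ Y) (S : FieldPair W)
    (hS : S.IsNatural) : (T.post G).mul S = (T.mul S).post (G ▷ W) := by
  ext1 <;> funext k
  · simp only [post, mul, SmoothOp.comp_assoc, smoothOf_comp_comp]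
    rw [associator_inv_naturality_left]
  · simp only [post, mul, SmoothOp.comp_assoc]
    rw [← SmoothOp.comp_assoc (S.R _), ← (hS (k ◁ G)).2]
    simp only [SmoothOp.comp_assoc, smoothOf_comp_comp]
    rw [associator_naturality_middle]

theorem mul_post {W : C.Obj} (T : FieldPair W) (hT : T.IsNatural) (S : FieldPair X)
    (G : X ⟶ Y) : T.mul (S.post G) = (T.mul S).post (W ◁ G) := by
  ext1 <;> funext k
  · simp only [post, mul, SmoothOp.comp_assoc]
    rw [← SmoothOp.comp_assoc (T.L _), ← (hT (G ▷ k)).1]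
    simp only [SmoothOp.comp_assoc, smoothOf_comp_comp]
    rw [associator_inv_naturality_middle]
  · simp only [post, mul, SmoothOp.comp_assoc, smoothOf_comp_comp]
    rw [associator_naturality_right]

theorem mul_mul (T : FieldPair X) (hT : T.IsNatural) (S : FieldPair Y) (U : FieldPair Z)
    (hU : U.IsNatural) : (T.mul S).mul U = (T.mul (S.mul U)).post (α_ X Y Z).inv := by
  ext1 <;> funext k
  · simp only [post, mul, SmoothOp.comp_assoc]
    rw [← SmoothOp.comp_assoc (T.L ((Y ⊗ Z) ⊗ k)),
      ← (hT (α_ Y Z k).inv).1]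
    simp only [SmoothOp.comp_assoc, smoothOf_comp_comp]
    congr 2
    simp
  · simp only [post, mul, SmoothOp.comp_assoc]
    rw [← SmoothOp.comp_assoc (U.R (k ⊗ X ⊗ Y)), ← (hU (α_ k X Y).hom).2]
    simp only [SmoothOp.comp_assoc, smoothOf_comp_comp]
    congr 2
    simp

namespace IsNatural

theorem post {T : FieldPair X} (hT : T.IsNatural) (G : X ⟶ Y) : (T.post G).IsNatural := by
  intro k k' f
  constructor
  · simp only [FieldPair.post, SmoothOp.comp_assoc]
    rw [← (hT f).1]
    simp only [smoothOf_comp_comp]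
    rw [whisker_exchange]
  · simp only [FieldPair.post, SmoothOp.comp_assoc]
    rw [← (hT f).2]
    simp only [smoothOf_comp_comp]
    rw [whisker_exchange]

theorem mul {T : FieldPair X} {S : FieldPair Y} (hT : T.IsNatural) (hS : S.IsNatural) :
    (T.mul S).IsNatural := by
  intro k k' f
  constructor
  · simp only [FieldPair.mul, SmoothOp.comp_assoc]
    rw [← (hS f).1, ← SmoothOp.comp_assoc (T.L _), ← (hT (Y ◁ f)).1]
    simp only [SmoothOp.comp_assoc, smoothOf_comp_comp]
    rw [associator_inv_naturality_right]
  · simp only [FieldPair.mul, SmoothOp.comp_assoc]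
    rw [← (hT f).2, ← SmoothOp.comp_assoc (S.R _), ← (hS (f ▷ X)).2]
    simp only [SmoothOp.comp_assoc, smoothOf_comp_comp]
    rw [associator_naturality_left]

/-- Naturality squares commute adjointly, since the adjoint of a morphism is a morphism. -/
theorem commutesAdjointly {T : FieldPair X} (hT : T.IsNatural) {k k' : C.Obj} (f : k ⟶ k') :
    SmoothOp.CommutesAdjointly (T.L k) (T.L k') (smoothOf f) (smoothOf (X ◁ f)) := by
  refine SmoothOp.commutesAdjointly_iff.2 ⟨(hT f).1, SmoothOp.comp_eq_of_dagger ?_⟩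
  rw [smoothOf_dagger, smoothOf_dagger, C.dag_whiskerLeft, (hT (dag f)).1]

theorem commutesAdjointly_right {T : FieldPair X} (hT : T.IsNatural) {k k' : C.Obj}
    (f : k ⟶ k') :
    SmoothOp.CommutesAdjointly (smoothOf f) (smoothOf (f ▷ X)) (T.R k) (T.R k') := by
  refine SmoothOp.commutesAdjointly_iff.2 ⟨(hT f).2.symm, ?_⟩
  rw [smoothOf_dagger, smoothOf_dagger, C.dag_whiskerRight, (hT (dag f)).2]

end IsNatural

/-! ### Locality of products -/

namespace IsLocalTo

theorem post_left {T : FieldPair X} {S : FieldPair Y} (h : T.IsLocalTo S) (hS : S.IsNatural)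
    (G : X ⟶ Z) : (T.post G).IsLocalTo S := by
  intro k
  refine (h k).vcomp ?_
  have h1 := hS.commutesAdjointly_right (G ▷ k)
  rw [SmoothOp.commutesAdjointly_iff] at h1 ⊢
  constructor
  · rw [SmoothOp.comp_assoc, h1.1]
    simp only [smoothOf_comp_comp]
    rw [associator_naturality_left]
  · rw [SmoothOp.comp_assoc, h1.2]
    simp only [smoothOf_comp_comp, smoothOf_dagger, C.dag_whiskerRight]
    rw [associator_naturality_left]

theorem post_right {T : FieldPair X} {S : FieldPair Y} (h : T.IsLocalTo S) (hT : T.IsNatural)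
    (G : Y ⟶ Z) : T.IsLocalTo (S.post G) := by
  intro k
  have := (h k).hcomp (hT.commutesAdjointly (k ◁ G))
  simp only [post, smoothOf_comp_comp] at this ⊢
  rwa [← associator_naturality_right] at this

theorem mul_left {W : C.Obj} {T : FieldPair X} {S : FieldPair Y} {U : FieldPair W}
    (hT : T.IsLocalTo U) (hS : S.IsLocalTo U) (nT : T.IsNatural) (nU : U.IsNatural) :
    (T.mul S).IsLocalTo U := by
  intro k
  refine SmoothOp.CommutesAdjointly.vcomp
    ((hS k).vcomp ((hT (Y ⊗ k)).hcomp (nT.commutesAdjointly (α_ Y k W).hom))) ?_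
  refine commutesAdjointly_of_unitary (α_ X Y k).symm (α_ X Y (k ⊗ W)).symm ?_ ?_ ?_
  · rw [Iso.symm_inv, Iso.symm_hom, C.associator_unitary, dag_dag]
  · rw [Iso.symm_inv, Iso.symm_hom, C.associator_unitary, dag_dag]
  · simp only [Iso.symm_hom, SmoothOp.comp_assoc]
    rw [← (nU (α_ X Y k).inv).2]
    simp only [smoothOf_comp_comp]
    congr 2
    simp

theorem mul_right {W : C.Obj} {T : FieldPair X} {S : FieldPair Y} {U : FieldPair W}
    (hS : T.IsLocalTo S) (hU : T.IsLocalTo U) (nT : T.IsNatural) (nU : U.IsNatural) :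
    T.IsLocalTo (S.mul U) := by
  intro k
  have := ((hS k).hcomp (hU (k ⊗ Y))).hcomp (nT.commutesAdjointly (α_ k Y W).hom)
  have e : smoothOf (X ◁ (α_ k Y W).hom) ⊚ (smoothOf (α_ X (k ⊗ Y) W).hom ⊚ U.R (X ⊗ k ⊗ Y)) ⊚
      smoothOf (α_ X k Y).hom ⊚ S.R (X ⊗ k) =
      smoothOf (α_ X k (Y ⊗ W)).hom ⊚ (S.mul U).R (X ⊗ k) := by
    simp only [mul, SmoothOp.comp_assoc]
    rw [← SmoothOp.comp_assoc (U.R _), ← (nU (α_ X k Y).hom).2]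
    simp only [SmoothOp.comp_assoc, smoothOf_comp_comp]
    congr 2
    simp
  rwa [e] at this

end IsLocalTo

/-! ### Braiding of products -/

namespace IsBraided

theorem post {T : FieldPair X} (h : T.IsBraided) (G : X ⟶ Y) : (T.post G).IsBraided := by
  intro k
  simp only [FieldPair.post, smoothOf_comp_comp, ← h k]
  rw [BraidedCategory.braiding_naturality_left]

/-- The hexagon moves `X` past `k` after `Y` has been moved past it; locality then exchanges
`L(T)` and `R(S)`. -/
theorem mul {T : FieldPair X} {S : FieldPair Y} (hT : T.IsBraided) (hS : S.IsBraided)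
    (nT : T.IsNatural) (nS : S.IsNatural) (h : T.IsLocalTo S) : (T.mul S).IsBraided := by
  intro k
  have h1 := (SmoothOp.commutesAdjointly_iff.1 (h k)).1
  simp only [FieldPair.mul]
  rw [← hT k, ← SmoothOp.comp_assoc (S.R _), ← (nS (β_ X k).hom).2, SmoothOp.comp_assoc]
  have h2 : S.R (X ⊗ k) ⊚ T.L k = smoothOf (α_ X k Y).inv ⊚ T.L (k ⊗ Y) ⊚ S.R k := by
    rw [← h1, SmoothOp.comp_assoc, smoothOf_comp_comp, Iso.hom_inv_id, smoothOf_id_comp]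
  rw [h2, ← hS k, ← SmoothOp.comp_assoc (T.L (k ⊗ Y)), ← (nT (β_ Y k).hom).1]
  simp only [SmoothOp.comp_assoc, smoothOf_comp_comp]
  congr 2
  simp

/-- Neutrality is the braiding with the unit object. -/
theorem neutral {T : FieldPair X} (h : T.IsBraided) :
    smoothOf (C.rightId X) ⊚ T.L C.vac = smoothOf (C.leftId X) ⊚ T.R C.vac := by
  rw [← h, smoothOf_comp_comp]
  congr 2
  rw [BraidedModuleCategory.rightId, BraidedModuleCategory.leftId,
    ← BraidedCategory.braiding_naturality_right_assoc, braiding_leftUnitor]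

theorem localizable {T : FieldPair X} (h : T.IsBraided) {k : C.Obj}
    (hL : (T.L k).IsLocalizable) : (T.R k).IsLocalizable := by
  rw [← h]
  exact hL.hom_comp _

end IsBraided

/-! ### Intertwining property and covariance of products -/

/-- Squares with morphisms as vertical sides and a local operator as horizontal sides. -/
theorem onModule_commutesAdjointly {I : Arc} {x : A.loc I} (hx : A.IsSmoothElt I x)
    (f : X ⟶ Y) : SmoothOp.CommutesAdjointly (smoothOf f) (smoothOf f)
      (hx.onModule X.obj) (hx.onModule Y.obj) :=
  ⟨LinearMap.ext fun ξ => Subtype.ext (NetModule.op_comm f.hom I x ξ).symm,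
    LinearMap.ext fun ξ => Subtype.ext (NetModule.op_comm (NetModule.adj f.hom) I x ξ).symm⟩

theorem onModule_commutesAdjointly_horizontal {I : Arc} {x : A.loc I} (hx : A.IsSmoothElt I x)
    (f : X ⟶ Y) : SmoothOp.CommutesAdjointly (hx.onModule X.obj) (hx.onModule Y.obj)
      (smoothOf f) (smoothOf f) := by
  have h := SmoothOp.commutesAdjointly_iff.1 (onModule_commutesAdjointly hx f)
  have h' := SmoothOp.commutesAdjointly_iff.1 (onModule_commutesAdjointly hx (dag f))
  refine SmoothOp.commutesAdjointly_iff.2 ⟨h.1.symm, ?_⟩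
  refine SmoothOp.comp_eq_of_dagger ?_
  rw [smoothOf_dagger, h'.1]

namespace CommutesWith

variable {I : Arc} {x : A.loc I} {hx : A.IsSmoothElt I x}

theorem post {T : FieldPair X} (h : T.CommutesWith hx) (G : X ⟶ Y) :
    (T.post G).CommutesWith hx := fun k =>
  ⟨(h k).1.vcomp (onModule_commutesAdjointly hx _),
    (h k).2.hcomp (onModule_commutesAdjointly_horizontal hx _)⟩

theorem mul {T : FieldPair X} {S : FieldPair Y} (hT : T.CommutesWith hx)
    (hS : S.CommutesWith hx) : (T.mul S).CommutesWith hx := fun k =>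
  ⟨((hS k).1.vcomp (hT _).1).vcomp (onModule_commutesAdjointly hx _),
    ((hT k).2.hcomp (hS _).2).hcomp (onModule_commutesAdjointly_horizontal hx _)⟩

end CommutesWith

namespace IsConj

variable {g : MobiusCover}

theorem post {T T' : FieldPair X} (h : IsConj g T T') (G : X ⟶ Y) :
    IsConj g (T.post G) (T'.post G) := by
  intro l η
  obtain ⟨hη, h1, h2⟩ := h l η
  refine ⟨hη, ?_, ?_⟩
  · refine (congrArg (opOf (G ▷ l)) h1).trans ?_
    exact NetModule.mob_natural (G ▷ l).hom g _
  · refine (congrArg (opOf (l ◁ G)) h2).trans ?_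
    exact NetModule.mob_natural (l ◁ G).hom g _

theorem mul {T T' : FieldPair X} {S S' : FieldPair Y} (hT : IsConj g T T')
    (hS : IsConj g S S') : IsConj g (T.mul S) (T'.mul S') := by
  have key : ∀ (M : NetModule A) (ξ ζ : M), ζ = (M.mob g : M →L[ℂ] M) ξ →
      ((star (M.mob g) : unitary (M →L[ℂ] M)) : M →L[ℂ] M) ζ = ξ := by
    rintro M ξ ζ rfl
    exact DFunLike.congr_fun (congrArg Subtype.val (Unitary.star_mul_self (M.mob g))) ξ
  intro l η
  obtain ⟨hη, hS1, -⟩ := hS l η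
  obtain ⟨_, -, hT2⟩ := hT l η
  refine ⟨hη, ?_, ?_⟩
  · obtain ⟨h', hT1, -⟩ := hT (Y ⊗ l) ((S'.L l).map η)
    refine (congrArg (opOf (α_ X Y l).inv) hT1).trans ?_
    refine (NetModule.mob_natural (α_ X Y l).inv.hom g _).trans ?_
    have e : (⟨_, h'⟩ : (Y ⊗ l).obj.smooth) = (S.L l).map ⟨_, hη⟩ := Subtype.ext (key _ _ _ hS1)
    rw [e]; rfl
  · obtain ⟨h', -, hS2⟩ := hS (l ⊗ X) ((T'.R l).map η)
    refine (congrArg (opOf (α_ l X Y).hom) hS2).trans ?_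
    refine (NetModule.mob_natural (α_ l X Y).hom.hom g _).trans ?_
    have e : (⟨_, h'⟩ : (l ⊗ X).obj.smooth) = (T.R l).map ⟨_, hη⟩ := Subtype.ext (key _ _ _ hT2)
    rw [e]; rfl

end IsConj

end FieldPair

namespace FieldSystem

variable {C : BraidedModuleCategory A} {F : Set C.Obj}

/-! ### Ordered products of fields -/

/-- The operators of the field with label `a` at `I`. -/
def letter (E : FieldSystem.{u, w} C F) {i : F} (I : ArgInterval) (a : E.charges i I) :
    FieldPair i.1 := ⟨E.L I a, E.R I a⟩

/-- The operators `L` and `R` of a word. -/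
def Word.pair {E : FieldSystem.{u, w} C F} {I : ArgInterval} (s : Word E I) : FieldPair s.obj :=
  ⟨s.left, s.right⟩

theorem Word.pair_cons {E : FieldSystem.{u, w} C F} {I : ArgInterval} (i : F)
    (a : E.charges i I) (s : Word E I) :
    (Word.cons i a s).pair = (E.letter I a).mul s.pair := rfl

/-- The operators of charge `X` localized in `J` that are obtained from the fields of `E` by
products in anticlockwise order and composition with morphisms. -/
inductive OrderedProduct (E : FieldSystem.{u, w} C F) :
    ∀ {X : C.Obj}, ArgInterval → FieldPair X → Prop
  | letter {i : F} {J : ArgInterval} (a : E.charges i J) : OrderedProduct E J (E.letter J a)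
  | mul {i : F} {Y : C.Obj} {J₁ J₂ J : ArgInterval} {T : FieldPair Y} (a : E.charges i J₁)
      (h₁ : J₁ ≤ J) (h₂ : J₂ ≤ J) (h : J₁.Anticlockwise J₂) (hT : OrderedProduct E J₂ T) :
      OrderedProduct E J ((E.letter J₁ a).mul T)
  | post {X Y : C.Obj} {J : ArgInterval} {T : FieldPair X} (hT : OrderedProduct E J T)
      (G : X ⟶ Y) : OrderedProduct E J (T.post G)

variable {E : FieldSystem.{u, w} C F}

theorem IsWeakExtension.letter_mono (hE : E.IsWeakExtension) {i : F} {I J : ArgInterval}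
    (h : I ≤ J) (a : E.charges i I) :
    E.letter I a = E.letter J ⟨a.1, E.mono h a.2⟩ :=
  FieldPair.ext (funext fun k => (hE.isotony h a k).1) (funext fun k => (hE.isotony h a k).2)

theorem IsWeakExtension.letter_natural (hE : E.IsWeakExtension) {i : F} {I : ArgInterval}
    (a : E.charges i I) : (E.letter I a).IsNatural := fun f =>
  ⟨SmoothOp.ext_map (hE.functoriality I a f).1, SmoothOp.ext_map (hE.functoriality I a f).2⟩

theorem IsWeakExtension.word_natural (hE : E.IsWeakExtension) {I : ArgInterval} (s : Word E I) :
    s.pair.IsNatural := by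
  induction s with
  | single i a => exact hE.letter_natural a
  | cons i a s ih => exact FieldPair.IsNatural.mul (hE.letter_natural a) ih

namespace OrderedProduct

variable {X : C.Obj} {J : ArgInterval} {T : FieldPair X}

theorem mono (hE : E.IsWeakExtension) (hT : OrderedProduct E J T) {I : ArgInterval}
    (h : J ≤ I) : OrderedProduct E I T := by
  induction hT generalizing I with
  | letter a => rw [hE.letter_mono h]; exact .letter _
  | mul a h₁ h₂ ha hT => exact .mul a (ArgInterval.le_trans h₁ h) (ArgInterval.le_trans h₂ h) ha hT
  | post hT G ih => exact .post (ih h) G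

/-- An ordered product is given by an ordered word whose letters are regarded as labels at any
larger interval `I`. -/
theorem exists_word (hE : E.IsWeakExtension) (hT : OrderedProduct E J T) {I : ArgInterval}
    (h : J ≤ I) : ∃ s : Word E I, s.IsOrdered J ∧ ∃ G : s.obj ⟶ X, T = s.pair.post G := by
  induction hT with
  | @letter i J a =>
    exact ⟨.single i ⟨a.1, E.mono h a.2⟩, a.2, 𝟙 _,
      (hE.letter_mono h a).trans (FieldPair.post_id _).symm⟩
  | @mul i Y J₁ J₂ J T a h₁ h₂ ha hT ih =>
    obtain ⟨s, hs, G, rfl⟩ := ih (ArgInterval.le_trans h₂ h)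
    refine ⟨.cons i ⟨a.1, E.mono (ArgInterval.le_trans h₁ h) a.2⟩ s, ⟨J₁, J₂, h₁, h₂, ha, a.2, hs⟩,
      i.1 ◁ G, ?_⟩
    rw [hE.letter_mono (ArgInterval.le_trans h₁ h), FieldPair.mul_post _ (hE.letter_natural _)]
    rfl
  | post hT G ih =>
    obtain ⟨s, hs, G', rfl⟩ := ih h
    exact ⟨s, hs, G' ≫ G, FieldPair.post_post _ _ _⟩

/-- Conversely, ordered words are ordered products, also when their letters are regarded as labels
at an interval `I` larger than the one they are localized in. -/
theorem of_word (hE : E.IsWeakExtension) {I : ArgInterval} (s : Word E I) (hs : s.IsOrdered J)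
    (h : J ≤ I) : OrderedProduct E J s.pair := by
  induction s generalizing J with
  | single i a =>
    have e : E.letter J ⟨a.1, hs⟩ = E.letter I a := hE.letter_mono h _
    have := OrderedProduct.letter (E := E) (J := J) ⟨a.1, hs⟩
    rwa [e] at this
  | cons i a s ih =>
    obtain ⟨J₁, J₂, h₁, h₂, ha, ha1, hs⟩ := hs
    rw [Word.pair_cons, ← hE.letter_mono (ArgInterval.le_trans h₁ h) ⟨a.1, ha1⟩]
    exact .mul _ h₁ h₂ ha (ih hs (ArgInterval.le_trans h₂ h))

theorem natural (hE : E.IsWeakExtension) (hT : OrderedProduct E J T) : T.IsNatural := by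
  induction hT with
  | letter a => exact hE.letter_natural a
  | mul a _ _ _ _ ih => exact FieldPair.IsNatural.mul (hE.letter_natural a) ih
  | post _ G ih => exact ih.post G

/-- Weak locality of a product and a single field; `isLocalTo` treats two products. -/
theorem isLocalTo_letter (hE : E.IsWeakExtension) (hT : OrderedProduct E J T) {i : F}
    {I : ArgInterval} (b : E.charges i I) (h : J.Anticlockwise I) :
    T.IsLocalTo (E.letter I b) := by
  induction hT with
  | letter a => exact hE.weak_locality _ _ h a b
  | mul a h₁ h₂ _ hT ih =>
    exact .mul_left (hE.weak_locality _ _ (h.mono h₁ (ArgInterval.le_refl _)) a b)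
      (ih (h.mono h₂ (ArgInterval.le_refl _)))
      (hE.letter_natural a) (hE.letter_natural b)
  | post hT G ih => exact (ih h).post_left (hE.letter_natural b) G

theorem isLocalTo (hE : E.IsWeakExtension) (hT : OrderedProduct E J T) {Y : C.Obj}
    {S : FieldPair Y} {I : ArgInterval} (hS : OrderedProduct E I S) (h : J.Anticlockwise I) :
    T.IsLocalTo S := by
  induction hS with
  | letter a => exact hT.isLocalTo_letter hE a h
  | mul a h₁ h₂ _ hS ih =>
    exact .mul_right (hT.isLocalTo_letter hE a (h.mono (ArgInterval.le_refl _) h₁))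
      (ih (h.mono (ArgInterval.le_refl _) h₂))
      (hT.natural hE) (hS.natural hE)
  | post hS G ih => exact (ih h).post_right (hT.natural hE) G

theorem isBraided (hE : E.IsWeakExtension) (hT : OrderedProduct E J T) : T.IsBraided := by
  have hl : ∀ {i : F} {J : ArgInterval} (a : E.charges i J), (E.letter J a).IsBraided :=
    fun a k => SmoothOp.ext_map (hE.braiding _ a k)
  induction hT with
  | letter a => exact hl a
  | mul a _ _ h hT ih =>
    exact .mul (hl a) ih (hE.letter_natural a) (hT.natural hE)
      ((OrderedProduct.letter a).isLocalTo hE hT h)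
  | post _ G ih => exact ih.post G

theorem commutesWith (hE : E.IsWeakExtension) (hT : OrderedProduct E J T) {I : ArgInterval}
    (h : J ≤ I) {x : A.loc I.compl.toArc} (hx : A.IsSmoothElt I.compl.toArc x) :
    T.CommutesWith hx := by
  have hl : ∀ {i : F} {J : ArgInterval} (_ : J ≤ I) (a : E.charges i J),
      (E.letter J a).CommutesWith hx := fun h a k => by
    rw [hE.letter_mono h a]
    exact hE.intertwining I _ k x hx
  induction hT with
  | letter a => exact hl h a
  | mul a h₁ h₂ _ _ ih =>
    exact (hl (ArgInterval.le_trans h₁ h) a).mul (ih (ArgInterval.le_trans h₂ h))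
  | post _ G ih => exact (ih h).post G

theorem covariant {g : MobiusCover} (hg : E.CovariantUnder g) (hT : OrderedProduct E J T) :
    ∃ T' : FieldPair X, OrderedProduct E (g.1.act J) T' ∧ FieldPair.IsConj g T T' := by
  induction hT with
  | letter a =>
    obtain ⟨b, hb⟩ := hg _ _ a
    exact ⟨_, .letter b, hb⟩
  | mul a h₁ h₂ h _ ih =>
    obtain ⟨b, hb⟩ := hg _ _ a
    obtain ⟨T', hT', hc⟩ := ih
    exact ⟨_, .mul b (ArgInterval.act_le _ h₁) (ArgInterval.act_le _ h₂) (h.act _) hT',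
      FieldPair.IsConj.mul hb hc⟩
  | post _ G ih =>
    obtain ⟨T', hT', hc⟩ := ih
    exact ⟨_, .post hT' G, hc.post G⟩

end OrderedProduct

/-! ### Localizability of products -/

/-- The product of words is, up to the associator, a word. -/
theorem IsWeakExtension.exists_word_mul (hE : E.IsWeakExtension) {I : ArgInterval}
    (s s' : Word E I) :
    ∃ (r : Word E I) (G : r.obj ⟶ s.obj ⊗ s'.obj), s.pair.mul s'.pair = r.pair.post G := by
  induction s with
  | single i a => exact ⟨.cons i a s', 𝟙 _, (FieldPair.post_id _).symm⟩
  | cons i a s ih =>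
    obtain ⟨r, G, h⟩ := ih
    refine ⟨.cons i a r, (i.1 ◁ G) ≫ (α_ i.1 s.obj s'.obj).inv, ?_⟩
    have e := FieldPair.mul_mul (E.letter I a) (hE.letter_natural a) s.pair s'.pair
      (hE.word_natural s')
    rw [h, FieldPair.mul_post _ (hE.letter_natural a), FieldPair.post_post] at e
    exact e

/-- If the fields of `E'` are words in the fields of `E` composed with morphisms, then so are
the words of `E'`. -/
theorem IsWeakExtension.exists_word_of_word (hE : E.IsWeakExtension) {F' : Set C.Obj}
    {E' : FieldSystem C F'} {I : ArgInterval}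
    (h : ∀ (i : F') (a : E'.charges i I),
      ∃ (r : Word E I) (G : r.obj ⟶ i.1), E'.letter I a = r.pair.post G)
    (s : Word E' I) : ∃ (r : Word E I) (G : r.obj ⟶ s.obj), s.pair = r.pair.post G := by
  induction s with
  | single i a => exact h i a
  | cons i a s ih =>
    obtain ⟨r, G, hr⟩ := ih
    obtain ⟨q, K, hq⟩ := h i a
    obtain ⟨p, L, hp⟩ := hE.exists_word_mul q r
    have n : ∀ r : Word E I, r.pair.IsNatural := hE.word_natural
    refine ⟨p, L ≫ (q.obj ◁ G) ≫ (K ▷ s.obj), ?_⟩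
    rw [Word.pair_cons, hr, hq, FieldPair.post_mul _ _ _ (FieldPair.IsNatural.post (n r) G),
      FieldPair.mul_post _ (n q), hp, FieldPair.post_post, FieldPair.post_post]
    rfl

theorem IsWeakLocalExtension.localizable (hE : E.IsWeakLocalExtension) {I : ArgInterval}
    (s : Word E I) {X : C.Obj} (G : s.obj ⟶ X) (k : C.Obj) :
    ((s.pair.post G).L k).IsLocalizable :=
  (hE.products_localizable s k).hom_comp (G ▷ k).hom

end FieldSystem

/-! ### Rotations and dense subspaces -/

/-- Rotations preserve smooth vectors, since they commute with each other and hence with `L₀`. -/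
theorem NetModule.mob_rho_smooth (M : NetModule A) (t : ℝ) {ξ : M} (hξ : ξ ∈ M.smooth) :
    (M.mob (rho t) : M →L[ℂ] M) ξ ∈ M.smooth := by
  have comm : ∀ (s : ℝ) (ζ : M), (M.mob (rho s) : M →L[ℂ] M) ((M.mob (rho t) : M →L[ℂ] M) ζ) =
      (M.mob (rho t) : M →L[ℂ] M) ((M.mob (rho s) : M →L[ℂ] M) ζ) := by
    intro s ζ
    have h : rho s * rho t = rho t * rho s := by
      refine Subtype.ext (Subtype.ext (Equiv.ext fun x => ?_))
      change x + t + s = x + s + t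
      ring
    have h' : M.mob (rho s) * M.mob (rho t) = M.mob (rho t) * M.mob (rho s) := by
      simp only [NetModule.mob, ← map_mul, h]
    exact DFunLike.congr_fun (congrArg Subtype.val h') ζ
  have key : ∀ n (a : M), M.InDomL0Pow n a →
      M.InDomL0Pow n ((M.mob (rho t) : M →L[ℂ] M) a) := by
    intro n
    induction n with
    | zero => intros; trivial
    | succ n ih =>
      rintro a ⟨a', ha, ha'⟩
      refine ⟨_, ?_, ih _ ha'⟩
      have := ((M.mob (rho t) : M →L[ℂ] M).restrictScalars ℝ).hasFDerivAt.comp_hasDerivAt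
        (0 : ℝ) ha
      unfold NetModule.IsL0
      simpa [Function.comp_def, comm] using this
  exact fun n => key n ξ (hξ n)

theorem dense_of_map_mem {M N : NetModule A} {D : Submodule ℂ M} {D' : Submodule ℂ N}
    (f : M →L[ℂ] N) (hf : Function.Surjective f) (hD : Dense (D : Set M))
    (h : ∀ x ∈ D, f x ∈ D') : Dense (D' : Set N) :=
  (hf.denseRange.dense_image f.continuous hD).mono (Set.image_subset_iff.2 h)

namespace BraidedModuleCategory

variable (C : BraidedModuleCategory A)

/-- The identification of `X ⊗ H₀` with `X`, as an isomorphism. -/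
def rightIdIso (X : C.Obj) : X ⊗ C.vac ≅ X := whiskerLeftIso X C.unitIso ≪≫ ρ_ X

variable {C}

/-- Tensoring with `Z` preserves finite sums of morphisms. The sums are taken among the underlying
operators, as the category carries no additive structure on its morphisms. -/
theorem opOf_whiskerRight_sum {ι : Type*} {X Y : C.Obj} (s : Finset ι) (f : ι → (X ⟶ Y))
    (h : X ⟶ Y) (hh : opOf h = ∑ i ∈ s, opOf (f i)) (Z : C.Obj) :
    opOf (h ▷ Z) = ∑ i ∈ s, opOf (f i ▷ Z) := by
  classical
  induction s using Finset.induction_on generalizing h with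
  | empty =>
    rw [Finset.sum_empty] at hh ⊢
    rw [C.whiskerRight_smul 0 h h Z (by rw [hh, smul_zero]), zero_smul]
  | insert a s ha ih =>
    have hc : ∀ (I : Arc) (x : A.loc I) (ξ : X.obj),
        (∑ i ∈ s, opOf (f i)) (X.obj.rep I x ξ) = Y.obj.rep I x ((∑ i ∈ s, opOf (f i)) ξ) := by
      intro I x ξ
      simp only [sum_apply, map_sum]
      exact Finset.sum_congr rfl fun i _ => NetModule.op_comm (f i).hom I x ξ
    let g : X ⟶ Y := ObjectProperty.homMk ⟨∑ i ∈ s, opOf (f i), hc⟩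
    rw [Finset.sum_insert ha] at hh ⊢
    rw [C.whiskerRight_add (f a) g h Z hh, ih g rfl]

end BraidedModuleCategory

theorem FieldPair.IsConj.map_apply {C : BraidedModuleCategory A} {X : C.Obj} {g : MobiusCover}
    {T T' : FieldPair X} (h : FieldPair.IsConj g T T') {k : C.Obj} {χ χ' : k.obj.smooth}
    (hχ : (χ' : k.obj) = (k.obj.mob g : k.obj →L[ℂ] k.obj) χ) :
    ((T'.L k).map χ' : (X ⊗ k).obj) =
      ((X ⊗ k).obj.mob g : (X ⊗ k).obj →L[ℂ] (X ⊗ k).obj) ((T.L k).map χ) := by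
  obtain ⟨h', h1, -⟩ := h k χ'
  have e : (⟨_, h'⟩ : k.obj.smooth) = χ := by
    refine Subtype.ext ?_
    simp only [hχ]
    exact DFunLike.congr_fun (congrArg Subtype.val (Unitary.star_mul_self (k.obj.mob g))) _
  rw [h1, e]

namespace FieldSystem

variable {C : BraidedModuleCategory A} {F : Set C.Obj} (E : FieldSystem.{u, w} C F)

/-- The span of the vectors `L(T) χ`, where `T` is an ordered product of fields of charge `X`
localized in `J`, and `χ` belongs to the set `S` of smooth vectors of `k`. -/
def productSpan {k : C.Obj} (S : Set k.obj.smooth) (X : C.Obj) (J : ArgInterval) :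
    Submodule ℂ (X ⊗ k).obj :=
  Submodule.span ℂ {ξ | ∃ T : FieldPair X, E.OrderedProduct J T ∧ ∃ χ ∈ S, ξ = (T.L k).map χ}

variable {E} {k : C.Obj} {S : Set k.obj.smooth} {X Y : C.Obj} {J : ArgInterval}

theorem productSpan_mono (hE : E.IsWeakExtension) {I : ArgInterval} (h : J ≤ I) :
    E.productSpan S X J ≤ E.productSpan S X I := by
  refine Submodule.span_mono ?_
  rintro ξ ⟨T, hT, χ, hχ, rfl⟩
  exact ⟨T, hT.mono hE h, χ, hχ, rfl⟩

theorem productSpan_post (G : X ⟶ Y) :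
    ∀ ξ ∈ E.productSpan S X J, opOf (G ▷ k) ξ ∈ E.productSpan S Y J := by
  change E.productSpan S X J ≤ (E.productSpan S Y J).comap (opOf (G ▷ k)).toLinearMap
  refine Submodule.span_le.2 ?_
  rintro ξ ⟨T, hT, χ, hχ, rfl⟩
  exact Submodule.subset_span ⟨_, hT.post G, χ, hχ, rfl⟩

/-- Products localized in a slightly smaller interval stay in `J` under small rotations. -/
theorem isDenseQRI_productSpan (hE : E.IsWeakExtension)
    (hS : ∀ t : ℝ, ∀ χ ∈ S, ∃ χ' ∈ S,
      (χ' : k.obj) = (k.obj.mob (rho t) : k.obj →L[ℂ] k.obj) χ)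
    (hD : ∀ I, Dense (E.productSpan S X I : Set (X ⊗ k).obj)) (J : ArgInterval) :
    (X ⊗ k).obj.IsDenseQRI (E.productSpan S X J) := by
  have h0 : 0 < (J.hi - J.lo) / 4 := by linarith [J.lo_lt]
  have h1 : 2 * ((J.hi - J.lo) / 4) < J.hi - J.lo := by linarith [J.lo_lt]
  refine ⟨Submodule.span_le.2 ?_, hD J, _, h0, E.productSpan S X (J.shrink _ h0 h1),
    productSpan_mono hE (ArgInterval.shrink_le h0 h1), hD _, fun t ht => ?_⟩
  · rintro ξ ⟨T, hT, χ, hχ, rfl⟩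
    exact ((T.L k).map χ).2
  · change E.productSpan S X _ ≤ (E.productSpan S X J).comap
      ((X ⊗ k).obj.mob (rho t) : (X ⊗ k).obj →L[ℂ] (X ⊗ k).obj).toLinearMap
    refine Submodule.span_le.2 ?_
    rintro ξ ⟨T, hT, χ, hχ, rfl⟩
    obtain ⟨T', hT', hc⟩ := hT.covariant (hE.rotation_covariance t)
    obtain ⟨χ', hχ', e⟩ := hS t χ hχ
    exact Submodule.subset_span ⟨T', hT'.mono hE (ArgInterval.act_rot_shrink_le h0 h1 ht), χ',
      hχ', (hc.map_apply e).symm⟩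

/-- By localizability, the dense space of products of charge `X` is a core for the fields of
charge `i`, so that applying these fields to it yields a dense space. -/
theorem dense_productSpan_tensor (hE : E.IsWeakExtension)
    (hS : ∀ t : ℝ, ∀ χ ∈ S, ∃ χ' ∈ S,
      (χ' : k.obj) = (k.obj.mob (rho t) : k.obj →L[ℂ] k.obj) χ)
    (hD : ∀ I, Dense (E.productSpan S X I : Set (X ⊗ k).obj)) (i : F) (J : ArgInterval) :
    Dense (E.productSpan S (i.1 ⊗ X) J : Set ((i.1 ⊗ X) ⊗ k).obj) := by
  obtain ⟨J₁, J₂, h₁, h₂, h⟩ := J.exists_halves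
  set K := (E.productSpan S (i.1 ⊗ X) J).topologicalClosure with hK
  have hKc : IsClosed (K : Set ((i.1 ⊗ X) ⊗ k).obj) := Submodule.isClosed_topologicalClosure _
  set f := opOf (α_ i.1 X k).inv with hf
  -- The fields `L(a)` map the core of products in `J₂` into products in `J`, hence everything
  -- into the closure of the latter.
  have hmem : ∀ (a : E.charges i J₁) (χ : (X ⊗ k).obj.smooth),
      f ((E.L J₁ a (X ⊗ k)).map χ) ∈ K := by
    intro a χ
    have hc : IsClosed {p : (X ⊗ k).obj × (i.1 ⊗ X ⊗ k).obj | f p.2 ∈ K} :=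
      hKc.preimage (f.continuous.comp continuous_snd)
    refine closure_minimal ?_ hc (hE.L_localizable J₁ a (X ⊗ k) _
      (isDenseQRI_productSpan hE hS hD J₂) χ)
    rintro _ ⟨ζ, hζ, rfl⟩
    refine Submodule.le_topologicalClosure _ ?_
    have hle : E.productSpan S X J₂ ≤ Submodule.map (X ⊗ k).obj.smooth.subtype
        ((E.productSpan S (i.1 ⊗ X) J).comap (f.toLinearMap ∘ₗ
          (i.1 ⊗ X ⊗ k).obj.smooth.subtype ∘ₗ (E.L J₁ a (X ⊗ k)).map)) := by
      refine Submodule.span_le.2 ?_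
      rintro ξ ⟨T, hT, χ, hχ, rfl⟩
      exact ⟨_, Submodule.subset_span ⟨_, .mul a h₁ h₂ h hT, χ, hχ, rfl⟩, rfl⟩
    obtain ⟨ζ', hζ', e⟩ := hle hζ
    rw [Submodule.subtype_apply, Subtype.coe_inj] at e
    subst e
    exact hζ'
  have hall : ∀ ζ, f ζ ∈ K := by
    have hle : Submodule.span ℂ {ξ : (i.1 ⊗ X ⊗ k).obj | ∃ (a : E.charges i J₁)
        (χ : (X ⊗ k).obj.smooth), ξ = (E.L J₁ a (X ⊗ k)).map χ} ≤ K.comap f.toLinearMap := by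
      refine Submodule.span_le.2 ?_
      rintro ξ ⟨a, χ, rfl⟩
      exact hmem a χ
    intro ζ
    exact closure_minimal hle (hKc.preimage f.continuous) (hE.density_L i J₁ (X ⊗ k) ζ)
  intro ζ
  have := hall (opOf (α_ i.1 X k).hom ζ)
  rwa [hf, opOf_iso_hom_inv] at this

/-- In a semisimple category generated by `F`, density of the fields with charges in `F` implies
density of the ordered products of every charge. -/
theorem dense_productSpan (hC : C.IsSemisimple) (hF : C.Generates F) (hE : E.IsWeakExtension)
    (hS : ∀ t : ℝ, ∀ χ ∈ S, ∃ χ' ∈ S,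
      (χ' : k.obj) = (k.obj.mob (rho t) : k.obj →L[ℂ] k.obj) χ)
    (hb : ∀ (i : F) (I : ArgInterval), Dense (E.productSpan S i.1 I : Set (i.1 ⊗ k).obj))
    (X : C.Obj) (J : ArgInterval) : Dense (E.productSpan S X J : Set (X ⊗ k).obj) := by
  have hlist : ∀ (l : List C.Obj) (Y : C.Obj), Y ∈ F → (∀ Z ∈ l, Z ∈ F) → ∀ I,
      Dense (E.productSpan S (C.tensorList Y l) I : Set (C.tensorList Y l ⊗ k).obj) := by
    intro l
    induction l with
    | nil => exact fun Y hY _ I => hb ⟨Y, hY⟩ I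
    | cons Z l ih =>
      intro Y hY hl I
      exact dense_productSpan_tensor hE hS
        (ih Z (hl Z (by simp)) fun W hW => hl W (by simp [hW])) ⟨Y, hY⟩ I
  have hirr : ∀ Y : C.Obj, Y.obj.IsIrreducible → ∀ I,
      Dense (E.productSpan S Y I : Set (Y ⊗ k).obj) := by
    intro Y hY I
    obtain ⟨Z, hZ, l, hl, v, hv⟩ := hF Y hY
    refine dense_of_map_mem (opOf (dag v ▷ k)) (fun ζ => ⟨opOf (v ▷ k) ζ, ?_⟩)
      (hlist l Z hZ hl I) (productSpan_post (dag v))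
    rw [← opOf_comp, ← comp_whiskerRight, hv, id_whiskerRight]
    rfl
  -- The decomposition of `X` into irreducible objects induces one of `X ⊗ k`.
  obtain ⟨n, Y, v, hv, hsum⟩ := hC X
  have hone : opOf (𝟙 X ▷ k) = ∑ m, opOf ((dag (v m) ≫ v m) ▷ k) := by
    refine BraidedModuleCategory.opOf_whiskerRight_sum _ _ _ ?_ k
    ext ξ
    rw [sum_apply]
    exact (hsum ξ).symm
  intro ζ
  have hζ : ζ = ∑ m, opOf (v m ▷ k) (opOf (dag (v m) ▷ k) ζ) := by
    have := DFunLike.congr_fun hone ζ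
    rw [id_whiskerRight, sum_apply] at this
    refine Eq.trans ?_ (this.trans (Finset.sum_congr rfl fun m _ => ?_))
    · rfl
    · rw [comp_whiskerRight, opOf_comp]
  rw [hζ]
  change _ ∈ (E.productSpan S X J).topologicalClosure
  refine Submodule.sum_mem _ fun m _ => ?_
  refine closure_minimal (t := {x | opOf (v m ▷ k) x ∈ (E.productSpan S X J).topologicalClosure})
    (fun x hx => Submodule.le_topologicalClosure _ (productSpan_post (v m) x hx)) ?_
    (hirr (Y m) (hv m).1 J (opOf (dag (v m) ▷ k) ζ))
  exact (Submodule.isClosed_topologicalClosure _).preimage (opOf (v m ▷ k)).continuous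

theorem dense_productSpan_smooth (hC : C.IsSemisimple) (hF : C.Generates F)
    (hE : E.IsWeakExtension) (k X : C.Obj) (J : ArgInterval) :
    Dense (E.productSpan (Set.univ : Set k.obj.smooth) X J : Set (X ⊗ k).obj) := by
  refine dense_productSpan hC hF hE ?_ (fun i I => ?_) X J
  · exact fun t χ _ => ⟨⟨_, k.obj.mob_rho_smooth t χ.2⟩, trivial, rfl⟩
  · refine (hE.density_L i I k).mono (Submodule.span_mono ?_)
    rintro ξ ⟨a, χ, rfl⟩
    exact ⟨_, .letter a, χ, trivial, rfl⟩

theorem dense_productSpan_vacuum (hC : C.IsSemisimple) (hF : C.Generates F)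
    (hE : E.IsWeakExtension) (X : C.Obj) (J : ArgInterval) :
    Dense (E.productSpan (k := C.vac) {A.Ωs} X J : Set (X ⊗ C.vac).obj) := by
  refine dense_productSpan hC hF hE ?_ (fun i I => ?_) X J
  · rintro t χ rfl
    exact ⟨_, rfl, (A.vacuum_mob_Ω _).symm⟩
  · refine dense_of_map_mem (opOf (C.rightIdIso i.1).inv)
      (fun ζ => ⟨_, opOf_iso_hom_inv (C.rightIdIso i.1) ζ⟩) (hE.reeh_schlieder i I) ?_
    change _ ≤ (E.productSpan (k := C.vac) {A.Ωs} i.1 I).comap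
      (opOf (C.rightIdIso i.1).inv).toLinearMap
    refine Submodule.span_le.2 ?_
    rintro ξ ⟨a, rfl⟩
    refine Submodule.subset_span ⟨_, .letter a, _, rfl, ?_⟩
    exact opOf_iso_hom_inv (C.rightIdIso i.1) _

end FieldSystem

namespace FieldSystem

variable {C : BraidedModuleCategory A} {F : Set C.Obj} (E : FieldSystem.{u, w} C F)

/-! ### The extension to all objects -/

/-- The extension of `E` to all objects. A label of charge `X` is a pair of families of operators,
localized in `I` if it is an ordered product of fields of `E` in an interval contained in `I`.
The labels of `E` are kept in addition: the operators of a label of `E` may depend on the interval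
at which it is used, so that such a label is not determined by a single pair. -/
def extension : FieldSystem.{u, max (u + 1) w} C Set.univ where
  Label X := FieldPair X.1 ⊕ (Σ' h : X.1 ∈ F, E.Label ⟨X.1, h⟩)
  charges X I := {a | match a with
    | .inl T => ∃ J ≤ I, E.OrderedProduct J T
    | .inr b => b.2 ∈ E.charges ⟨X.1, b.1⟩ I}
  mono := by
    rintro X I J h (T | b) ha
    · obtain ⟨K, hK, hT⟩ := ha
      exact ⟨K, ArgInterval.le_trans hK h, hT⟩
    · exact E.mono h ha
  L I a k := match a with
    | ⟨.inl T, _⟩ => T.L k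
    | ⟨.inr b, hb⟩ => E.L (i := ⟨_, b.1⟩) I ⟨b.2, hb⟩ k
  R I a k := match a with
    | ⟨.inl T, _⟩ => T.R k
    | ⟨.inr b, hb⟩ => E.R (i := ⟨_, b.1⟩) I ⟨b.2, hb⟩ k

variable {E}

theorem extension_orderedProduct (hE : E.IsWeakExtension) {X : (Set.univ : Set C.Obj)}
    {I : ArgInterval} (a : E.extension.charges X I) :
    E.OrderedProduct I (E.extension.letter I a) := by
  obtain ⟨T | ⟨hX, b⟩, ha⟩ := a
  · obtain ⟨J, hJ, hT⟩ := ha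
    exact hT.mono hE hJ
  · exact OrderedProduct.letter (E := E) (i := ⟨X.1, hX⟩) ⟨b, ha⟩

theorem exists_extension_letter {X : C.Obj} {I : ArgInterval} {T : FieldPair X}
    (hT : E.OrderedProduct I T) :
    ∃ a : E.extension.charges ⟨X, trivial⟩ I, E.extension.letter I a = T :=
  ⟨⟨.inl T, I, ArgInterval.le_refl I, hT⟩, rfl⟩

theorem extension_covariantUnder (hE : E.IsWeakExtension) {g : MobiusCover}
    (hg : E.CovariantUnder g) : E.extension.CovariantUnder g := by
  intro X I a
  obtain ⟨T', hT', hc⟩ := (extension_orderedProduct hE a).covariant hg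
  obtain ⟨b, rfl⟩ := exists_extension_letter hT'
  exact ⟨b, hc⟩

theorem extension_products_localizable (hE : E.IsWeakLocalExtension) {I : ArgInterval}
    (s : Word E.extension I) (k : C.Obj) : (s.left k).IsLocalizable := by
  obtain ⟨r, G, h⟩ := hE.exists_word_of_word (fun X a => by
    obtain ⟨r, -, G, h⟩ := (extension_orderedProduct hE.toIsWeakExtension a).exists_word
      hE.toIsWeakExtension (ArgInterval.le_refl I)
    exact ⟨r, G, h⟩) s
  have := hE.localizable r G k
  rwa [← h] at this

theorem extension_dense_L (hC : C.IsSemisimple) (hF : C.Generates F) (hE : E.IsWeakExtension)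
    (X : (Set.univ : Set C.Obj)) (I : ArgInterval) (k : C.Obj) :
    Dense (Submodule.span ℂ {ξ : (X.1 ⊗ k).obj | ∃ (a : E.extension.charges X I)
      (χ : k.obj.smooth), ξ = (E.extension.L I a k).map χ} : Set (X.1 ⊗ k).obj) := by
  refine (dense_productSpan_smooth hC hF hE k X.1 I).mono (Submodule.span_mono ?_)
  rintro ξ ⟨T, hT, χ, -, rfl⟩
  obtain ⟨a, rfl⟩ := exists_extension_letter hT
  exact ⟨a, χ, rfl⟩

theorem extension_isWeakLocalExtension (hC : C.IsSemisimple) (hF : C.Generates F)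
    (hE : E.IsWeakLocalExtension) : E.extension.IsWeakLocalExtension := by
  have hw := hE.toIsWeakExtension
  have hp := @extension_orderedProduct (hE := hw)
  have hL : ∀ {X : (Set.univ : Set C.Obj)} (I : ArgInterval) (a : E.extension.charges X I)
      (k : C.Obj), (E.extension.L I a k).IsLocalizable := fun I a k =>
    extension_products_localizable hE (.single _ a) k
  refine
    { L_localizable := hL
      R_localizable := fun I a k => ((hp a).isBraided hw).localizable (hL I a k)
      isotony := ?_
      functoriality := fun I a k k' f => ?_
      neutrality := fun I a => congrArg SmoothOp.map ((hp a).isBraided hw).neutral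
      reeh_schlieder := fun X I => ?_
      density_L := extension_dense_L hC hF hw
      density_R := fun X I k => ?_
      intertwining := fun I a k x hx => (hp a).commutesWith hw (ArgInterval.le_refl I) hx k
      weak_locality := fun I J h a b => (hp a).isLocalTo hw (hp b) h
      braiding := fun I a k => congrArg SmoothOp.map ((hp a).isBraided hw k)
      rotation_covariance := fun t => extension_covariantUnder hw (hw.rotation_covariance t)
      products_localizable := extension_products_localizable hE }
  · rintro X I J h ⟨T | b, ha⟩ k
    · exact ⟨rfl, rfl⟩
    · exact hw.isotony h _ k
  · exact ⟨congrArg SmoothOp.map ((hp a).natural hw f).1,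
      congrArg SmoothOp.map ((hp a).natural hw f).2⟩
  · refine dense_of_map_mem (opOf (C.rightIdIso X.1).hom)
      (fun ζ => ⟨_, opOf_iso_inv_hom (C.rightIdIso X.1) ζ⟩)
      (dense_productSpan_vacuum hC hF hw X.1 I) ?_
    change _ ≤ (Submodule.span ℂ _).comap (opOf (C.rightIdIso X.1).hom).toLinearMap
    refine Submodule.span_le.2 ?_
    rintro ξ ⟨T, hT, χ, rfl, rfl⟩
    obtain ⟨a, rfl⟩ := exists_extension_letter hT
    exact Submodule.subset_span ⟨a, rfl⟩
  · refine dense_of_map_mem (opOf (β_ X.1 k).hom) (fun ζ => ⟨_, opOf_iso_inv_hom (β_ X.1 k) ζ⟩)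
      (extension_dense_L hC hF hw X I k) ?_
    change _ ≤ (Submodule.span ℂ _).comap (opOf (β_ X.1 k).hom).toLinearMap
    refine Submodule.span_le.2 ?_
    rintro ξ ⟨a, χ, rfl⟩
    refine Submodule.subset_span ⟨a, χ, ?_⟩
    exact congrArg (fun T : SmoothOp _ _ => (T.map χ : (k ⊗ X.1).obj)) ((hp a).isBraided hw k)

theorem extension_extends : E.extension.Extends E := by
  refine ⟨fun i a => .inr ⟨i.2, a⟩, fun i a b h => ?_, fun i I a => a.2,
    fun i I a k => ⟨rfl, rfl⟩⟩
  have := Sum.inr.inj h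
  cases this
  rfl

theorem extension_isBuiltFrom (hE : E.IsWeakExtension) : E.extension.IsBuiltFrom E := by
  refine fun X I => ⟨fun a => ?_, fun s hs G => ?_⟩
  · obtain ⟨s, hs, G, h⟩ := (extension_orderedProduct hE a).exists_word hE (ArgInterval.le_refl I)
    exact ⟨s, hs, G, fun k => ⟨congrFun (congrArg FieldPair.L h) k,
      congrFun (congrArg FieldPair.R h) k⟩⟩
  · obtain ⟨a, h⟩ := exists_extension_letter
      ((OrderedProduct.of_word hE s hs (ArgInterval.le_refl I)).post G)
    exact ⟨a, fun k => ⟨congrFun (congrArg FieldPair.L h) k,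
      congrFun (congrArg FieldPair.R h) k⟩⟩

end FieldSystem

end Fields

end

theorem mainTheorem11 {H : Type u} [NormedAddCommGroup H] [InnerProductSpace ℂ H]
    [CompleteSpace H] [TopologicalSpace.SeparableSpace H]
    (A : ConformalNet H) (C : BraidedModuleCategory A) (hC : C.IsSemisimple)
    (F : Set C.Obj) (hF : C.Generates F)
    (E : FieldSystem.{u, w} C F) (hE : E.IsWeakLocalExtension) :
    ∃ E' : FieldSystem.{u, max (u + 1) w} C Set.univ,
      E'.IsWeakLocalExtension ∧ E'.Extends E ∧ E'.IsBuiltFrom E ∧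
        (E.IsMobiusCovariant → E'.IsMobiusCovariant) :=
  ⟨E.extension, FieldSystem.extension_isWeakLocalExtension hC hF hE,
    FieldSystem.extension_extends, FieldSystem.extension_isBuiltFrom hE.toIsWeakExtension,
    fun h g => FieldSystem.extension_covariantUnder hE.toIsWeakExtension (h g)⟩
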